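/- Let $n\ge 2$ and $m\ge 1$ be integers and let $q\in\mathbb C$ be a primitive $m$-th root of unity. Put $m'=m$ if $m$ is odd and $m'=m/2$ if $m$ is even. Let $J^0_q(n)$ be the associative unital $\mathbb C$-algebra with generators $Z_{i,j}$, $1\le i,j\le n$, and defining relations $$Z_{i,j}Z_{s,t}=q^{s+t-i-j}Z_{s,t}Z_{i,j}\quad\text{if }(s-i)(t-j)\le 0,$$ $$q^{1-t+j}Z_{i,j}Z_{s,t}=q^{s-i-1}Z_{s,t}Z_{i,j}+(q-q^{-1})Z_{i,t}Z_{s,j}\quad\text{if }s>i\text{ and }t>j.$$ For $\Lambda=(\lambda_1,\dots,\lambda_n)\in\mathbb C^n$ and $\phi\in\mathbb C$, let $\overline{I^0(\Lambda,\phi)}$ be the left ideal of $J^0_q(n)$ generated by the elements $Z_{i,j}$ with $i+j\ge n+2$, the elements $Z_{k,n+1-k}-\lambda_k$ for $k=1,\dots,n$, the element $Z_{n-1,1}^m-\phi$, and the elements $Z_{i,j}^{m'}$ with $i+j\le n$ and $(i,j)\ne(n-1,1)$. The restricted minimally generalized Verma module is the left $J^0_q(n)$-module $\overline{M^0(\Lambda,\phi)}=J^0_q(n)/\overline{I^0(\Lambda,\phi)}$.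 Theorem. For $\phi=1$ and $\Lambda=(1,\dots,1)$, the module $\overline{M^0(\Lambda,\phi)}$ is irreducible, and it is finite dimensional over $\mathbb C$, of dimension $m\cdot(m')^{(n^2-n-2)/2}$. -/

import Mathlib

noncomputable section

/-- The number `m'`: it is `m` if `m` is odd and `m / 2` if `m` is even. -/
def mPrime (m : ℕ) : ℕ := if Even m then m / 2 else m

/-- The defining relations of `J⁰_q(n)` between the free generators `J_{i,j}`.
The indices `i, j, s, t` run over `Fin n`, so they are the usual indices `1, …, n` lowered by one;
the relations involve differences of indices only. -/
inductive JZeroRel (n : ℕ) (q : ℂ) :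
    FreeAlgebra ℂ (Fin n × Fin n) → FreeAlgebra ℂ (Fin n × Fin n) → Prop
  | comm (i j s t : Fin n) (h : ((s : ℤ) - (i : ℤ)) * ((t : ℤ) - (j : ℤ)) ≤ 0) :
      JZeroRel n q
        (FreeAlgebra.ι ℂ (i, j) * FreeAlgebra.ι ℂ (s, t))
        (q ^ ((s : ℤ) + (t : ℤ) - (i : ℤ) - (j : ℤ)) •
          (FreeAlgebra.ι ℂ (s, t) * FreeAlgebra.ι ℂ (i, j)))
  | cross (i j s t : Fin n) (his : i < s) (hjt : j < t) :
      JZeroRel n q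
        (q ^ (1 - (t : ℤ) + (j : ℤ)) •
          (FreeAlgebra.ι ℂ (i, j) * FreeAlgebra.ι ℂ (s, t)))
        (q ^ ((s : ℤ) - (i : ℤ) - 1) •
            (FreeAlgebra.ι ℂ (s, t) * FreeAlgebra.ι ℂ (i, j)) +
          (q - q⁻¹) • (FreeAlgebra.ι ℂ (i, t) * FreeAlgebra.ι ℂ (s, j)))

/-- The quadratic matrix algebra `J⁰_q(n)` over `ℂ`. -/
abbrev JZero (n : ℕ) (q : ℂ) : Type := RingQuot (JZeroRel n q)

/-- The generator of `J⁰_q(n)` with (zero-based) row index `i` and column index `j`. -/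
def JZero.gen (n : ℕ) (q : ℂ) (i j : Fin n) : JZero n q :=
  RingQuot.mkAlgHom ℂ (JZeroRel n q) (FreeAlgebra.ι ℂ (i, j))

/-- The elements generating the left ideal that defines the restricted minimally generalized Verma
module. For `i : Fin n`, the number `i + 1` is the usual index in `1, …, n`. -/
inductive VermaIdealGenerator (n : ℕ) (q : ℂ) (m : ℕ) (Λ : Fin n → ℂ) (φ : ℂ) :
    JZero n q → Prop
  /-- `Z_{i,j}` for `i + j ≥ n + 2`. -/
  | raising (i j : Fin n) (h : n + 2 ≤ (i.val + 1) + (j.val + 1)) :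
      VermaIdealGenerator n q m Λ φ (JZero.gen n q i j)
  /-- `Z_{k,n+1-k} - λ_k` for `k = 1, …, n`. -/
  | weight (k l : Fin n) (h : (k.val + 1) + (l.val + 1) = n + 1) :
      VermaIdealGenerator n q m Λ φ
        (JZero.gen n q k l - algebraMap ℂ (JZero n q) (Λ k))
  /-- `Z_{n-1,1} ^ m - φ`. -/
  | cyclic (i j : Fin n) (hi : (i.val + 1) + 1 = n) (hj : j.val + 1 = 1) :
      VermaIdealGenerator n q m Λ φ
        (JZero.gen n q i j ^ m - algebraMap ℂ (JZero n q) φ)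
  /-- `Z_{i,j} ^ m'` for `i + j ≤ n`, `(i, j) ≠ (n - 1, 1)`. -/
  | nilpotent (i j : Fin n) (h : (i.val + 1) + (j.val + 1) ≤ n)
      (hne : ¬ ((i.val + 1) + 1 = n ∧ j.val + 1 = 1)) :
      VermaIdealGenerator n q m Λ φ (JZero.gen n q i j ^ mPrime m)

/-- The left ideal generated by these elements. -/
def restrictedVermaIdeal (n : ℕ) (q : ℂ) (m : ℕ) (Λ : Fin n → ℂ) (φ : ℂ) :
    Submodule (JZero n q) (JZero n q) :=
  Submodule.span (JZero n q) {x | VermaIdealGenerator n q m Λ φ x}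

/-- The restricted minimally generalized Verma module of `J⁰_q(n)`, the quotient of the left
regular module by the left ideal. -/
abbrev RestrictedVerma (n : ℕ) (q : ℂ) (m : ℕ) (Λ : Fin n → ℂ) (φ : ℂ) : Type :=
  JZero n q ⧸ restrictedVermaIdeal n q m Λ φ

end

noncomputable section

set_option linter.unusedSectionVars false
set_option linter.unusedSimpArgs false
set_option linter.unnecessarySeqFocus false

/-! Write `n = N + 1` and index from `0`. The dimension is bounded above by reordering words and
below by an explicit irreducible representation of the same size; the two bounds make the module
isomorphic to that representation.

Upper bound: modulo words of smaller weight the generators commute up to scalars, and modulo the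
ideal each `exponentBound`-th power of a generator is a scalar. Hence the ordered monomials with
exponents in `Exponents N m` span the module (`span_exponentWord`).

Lower bound: on functions of the exponents, a tensor product with one factor per position, each
position `i + j < N` carries a `q`-oscillator `[[A, B], [B, D]]`, a quantum `2 × 2` matrix with
scalar `q`-determinant. Multiplying such blocks, one per adjacent pair of rows and level by level,
gives a quantum matrix `qmat`. Its entries are homogeneous for a torus grading, so multiplying them
by suitable diagonal operators (`twist`) turns the quantum matrix relations into those of `J⁰_q(n)`.
The vacuum vector is killed by the generators of the left ideal (`rep_apply_eq_zero`), so the module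
maps to this space.

Irreducibility (`eq_top_of_ne_bot`): in a nonzero invariant subspace, a vector of least degree is
killed by all entries that lower the degree, hence by every annihilation operator
(`exists_annihilated`). Its support then lies at exponents divisible by `m'`, which leaves at most
two monomials, both powers of the cyclic generator. The corner entry separates them, so the vacuum
is reached (`vacuum_mem`), and the creation operators produce everything from it
(`eq_top_of_vacuum_mem`). -/

/-- The defining relations of the coordinate algebra of quantum matrices. -/
structure IsQuantumMatrix {𝒜 : Type*} [Ring 𝒜] [Algebra ℂ 𝒜] (q : ℂ) (Z : ℕ → ℕ → 𝒜) : Prop where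
  row : ∀ (i : ℕ) {j t : ℕ}, j < t → Z i j * Z i t = q • (Z i t * Z i j)
  col : ∀ {i s : ℕ} (j : ℕ), i < s → Z i j * Z s j = q • (Z s j * Z i j)
  anti : ∀ {i s j t : ℕ}, i < s → t < j → Z i j * Z s t = Z s t * Z i j
  cross : ∀ {i s j t : ℕ}, i < s → j < t →
    Z i j * Z s t = Z s t * Z i j + (q - q⁻¹) • (Z i t * Z s j)

/-- The relations of a `q`-oscillator: creation `A`, weight `B`, annihilation `D`. -/
structure IsOscillator {𝒜 : Type*} [Ring 𝒜] [Algebra ℂ 𝒜] (q : ℂ) (A B D : 𝒜) : Prop where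
  ab : A * B = q • (B * A)
  bd : B * D = q • (D * B)
  da : D * A = q⁻¹ • (B * B) - q • 1
  ad : A * D = q • (B * B) - q • 1

/-! ### Row operations by oscillator blocks preserve the quantum matrix relations. -/

section Algebraic

variable {𝒜 : Type*} [Ring 𝒜] [Algebra ℂ 𝒜]

/-- Left multiplication by the matrix with the block `[[A, B], [B, D]]` in rows `s`, `s + 1`. -/
def rowOp (s : ℕ) (A B D : 𝒜) (Z : ℕ → ℕ → 𝒜) (i j : ℕ) : 𝒜 :=
  if i = s then A * Z s j + B * Z (s + 1) j
  else if i = s + 1 then B * Z s j + D * Z (s + 1) j else Z i j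

lemma rowOp_self (s : ℕ) (A B D : 𝒜) (Z : ℕ → ℕ → 𝒜) (j : ℕ) :
    rowOp s A B D Z s j = A * Z s j + B * Z (s + 1) j := by simp [rowOp]

lemma rowOp_succ (s : ℕ) (A B D : 𝒜) (Z : ℕ → ℕ → 𝒜) (j : ℕ) :
    rowOp s A B D Z (s + 1) j = B * Z s j + D * Z (s + 1) j := by simp [rowOp]

lemma rowOp_of_ne (s : ℕ) (A B D : 𝒜) (Z : ℕ → ℕ → 𝒜) {i : ℕ} (j : ℕ) (h : i ≠ s)
    (h' : i ≠ s + 1) : rowOp s A B D Z i j = Z i j := by simp [rowOp, h, h']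

lemma mul_mul_of_eq {a b c : 𝒜} (h : a * b = c) (w : 𝒜) : a * (b * w) = c * w := by
  rw [← mul_assoc, h]

/-- The block `[[A, B], [B, D]]`, completed by an identity, is itself a quantum matrix, and the
product of two quantum matrices whose entries commute with each other is again one. Only rows `s`
and `s + 1` mix, so the nontrivial cases are those involving both; elsewhere the relations are
linear in the mixed row. -/
lemma IsQuantumMatrix.rowOp {q : ℂ} (hq : q ≠ 0) {A B D : 𝒜} {Z : ℕ → ℕ → 𝒜}
    (hZ : IsQuantumMatrix q Z) (h : IsOscillator q A B D) (s : ℕ)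
    (hA : ∀ i j, Z i j * A = A * Z i j) (hB : ∀ i j, Z i j * B = B * Z i j)
    (hD : ∀ i j, Z i j * D = D * Z i j) : IsQuantumMatrix q (rowOp s A B D Z) := by
  have hA' := fun i j => mul_mul_of_eq (hA i j)
  have hB' := fun i j => mul_mul_of_eq (hB i j)
  have hD' := fun i j => mul_mul_of_eq (hD i j)
  have ab' := mul_mul_of_eq h.ab
  have bd' := mul_mul_of_eq h.bd
  have da' := mul_mul_of_eq h.da
  have ad' := mul_mul_of_eq h.ad
  have hs : s < s + 1 := s.lt_succ_self
  refine ⟨fun i j t hjt => ?_, fun {i k} j hik => ?_, fun {i k t j} hik hjt => ?_,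
    fun {i k j t} hik hjt => ?_⟩
  · by_cases h1 : i = s
    · rw [h1]
      have r1 := hZ.row s hjt
      have r2 := hZ.row (s + 1) hjt
      have c1 := hZ.col j hs
      have c2 := hZ.col t hs
      -- With this relation the cross relation is brought to the normal form with the lower row on
      -- the left, so that both sides reduce to the same monomials.
      have a1 := hZ.anti hs hjt
      have x1 := hZ.cross hs hjt
      rw [a1] at x1
      rw [rowOp_self, rowOp_self]
      simp only [mul_add, add_mul, mul_assoc, smul_mul_assoc, mul_smul_comm, smul_add, smul_smul,
        hA', hB', hD', ab', bd', da', ad', sub_mul, mul_sub, one_mul, smul_sub, r1, r2, c1, c2,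
          a1, x1]
      match_scalars <;> field_simp <;> ring
    by_cases h2 : i = s + 1
    · rw [h2]
      have r1 := hZ.row s hjt
      have r2 := hZ.row (s + 1) hjt
      have c1 := hZ.col j hs
      have c2 := hZ.col t hs
      have a1 := hZ.anti hs hjt
      have x1 := hZ.cross hs hjt
      rw [a1] at x1
      rw [rowOp_succ, rowOp_succ]
      simp only [mul_add, add_mul, mul_assoc, smul_mul_assoc, mul_smul_comm, smul_add, smul_smul,
        hA', hB', hD', ab', bd', da', ad', sub_mul, mul_sub, one_mul, smul_sub, r1, r2, c1, c2,
          a1, x1]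
      match_scalars <;> field_simp <;> ring
    · rw [rowOp_of_ne _ _ _ _ _ _ h1 h2, rowOp_of_ne _ _ _ _ _ _ h1 h2]
      exact hZ.row i hjt
  · by_cases h1 : i = s
    · by_cases h2 : k = s + 1
      · rw [h1, h2]
        have c1 := hZ.col j hs
        simp only [rowOp_self, rowOp_succ]
        simp only [mul_add, add_mul, mul_assoc, smul_mul_assoc, mul_smul_comm, smul_add, smul_smul,
            hA', hB', hD', ab', bd', da', ad', sub_mul, mul_sub, one_mul, smul_sub, c1]
        match_scalars <;> field_simp
      · rw [h1]
        have e0 := hZ.col j (show s < k by omega)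
        have e1 := hZ.col j (show s + 1 < k by omega)
        simp only [rowOp_self, rowOp_of_ne _ _ _ _ _ _ (show k ≠ s by omega)
          (show k ≠ s + 1 by omega)]
        simp only [mul_add, add_mul, mul_assoc, smul_mul_assoc, mul_smul_comm, smul_add, smul_smul,
            hA', hB', hD', ab', bd', da', ad', sub_mul, mul_sub, one_mul, smul_sub, e0, e1]
        try abel
    by_cases h2 : i = s + 1
    · rw [h2]
      have e0 := hZ.col j (show s < k by omega)
      have e1 := hZ.col j (show s + 1 < k by omega)
      simp only [rowOp_succ, rowOp_of_ne _ _ _ _ _ _ (show k ≠ s by omega)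
          (show k ≠ s + 1 by omega)]
      simp only [mul_add, add_mul, mul_assoc, smul_mul_assoc, mul_smul_comm, smul_add, smul_smul,
          hA', hB', hD', ab', bd', da', ad', sub_mul, mul_sub, one_mul, smul_sub, e0, e1]
      try abel
    by_cases h3 : k = s
    · rw [h3]
      have e0 := hZ.col j (show i < s by omega)
      have e1 := hZ.col j (show i < s + 1 by omega)
      simp only [rowOp_self, rowOp_of_ne _ _ _ _ _ _ (show i ≠ s by omega)
          (show i ≠ s + 1 by omega)]
      simp only [mul_add, add_mul, mul_assoc, smul_mul_assoc, mul_smul_comm, smul_add, smul_smul,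
          hA', hB', hD', ab', bd', da', ad', sub_mul, mul_sub, one_mul, smul_sub, e0, e1]
      try abel
    by_cases h4 : k = s + 1
    · rw [h4]
      have e0 := hZ.col j (show i < s by omega)
      have e1 := hZ.col j (show i < s + 1 by omega)
      simp only [rowOp_succ, rowOp_of_ne _ _ _ _ _ _ (show i ≠ s by omega)
          (show i ≠ s + 1 by omega)]
      simp only [mul_add, add_mul, mul_assoc, smul_mul_assoc, mul_smul_comm, smul_add, smul_smul,
          hA', hB', hD', ab', bd', da', ad', sub_mul, mul_sub, one_mul, smul_sub, e0, e1]
      try abel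
    · simp only [rowOp_of_ne _ _ _ _ _ _ h1 h2, rowOp_of_ne _ _ _ _ _ _ h3 h4]
      exact hZ.col j hik
  · by_cases h1 : i = s
    · by_cases h2 : k = s + 1
      · rw [h1, h2]
        have r1 := hZ.row s hjt
        have r2 := hZ.row (s + 1) hjt
        have c1 := hZ.col j hs
        have c2 := hZ.col t hs
        have a1 := hZ.anti hs hjt
        have x1 := hZ.cross hs hjt
        rw [a1] at x1
        simp only [rowOp_self, rowOp_succ]
        simp only [mul_add, add_mul, mul_assoc, smul_mul_assoc, mul_smul_comm, smul_add, smul_smul,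
            hA', hB', hD', ab', bd', da', ad', sub_mul, mul_sub, one_mul, smul_sub, r1, r2, c1, c2,
          a1, x1]
        match_scalars <;> field_simp <;> ring
      · rw [h1]
        have e0 := hZ.anti (show s < k by omega) hjt
        have e1 := hZ.anti (show s + 1 < k by omega) hjt
        simp only [rowOp_self, rowOp_of_ne _ _ _ _ _ _ (show k ≠ s by omega)
          (show k ≠ s + 1 by omega)]
        simp only [mul_add, add_mul, mul_assoc, smul_mul_assoc, mul_smul_comm, smul_add, smul_smul,
            hA', hB', hD', ab', bd', da', ad', sub_mul, mul_sub, one_mul, smul_sub, e0, e1]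
        try abel
    by_cases h2 : i = s + 1
    · rw [h2]
      have e0 := hZ.anti (show s < k by omega) hjt
      have e1 := hZ.anti (show s + 1 < k by omega) hjt
      simp only [rowOp_succ, rowOp_of_ne _ _ _ _ _ _ (show k ≠ s by omega)
          (show k ≠ s + 1 by omega)]
      simp only [mul_add, add_mul, mul_assoc, smul_mul_assoc, mul_smul_comm, smul_add, smul_smul,
          hA', hB', hD', ab', bd', da', ad', sub_mul, mul_sub, one_mul, smul_sub, e0, e1]
      try abel
    by_cases h3 : k = s
    · rw [h3]
      have e0 := hZ.anti (show i < s by omega) hjt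
      have e1 := hZ.anti (show i < s + 1 by omega) hjt
      simp only [rowOp_self, rowOp_of_ne _ _ _ _ _ _ (show i ≠ s by omega)
          (show i ≠ s + 1 by omega)]
      simp only [mul_add, add_mul, mul_assoc, smul_mul_assoc, mul_smul_comm, smul_add, smul_smul,
          hA', hB', hD', ab', bd', da', ad', sub_mul, mul_sub, one_mul, smul_sub, e0, e1]
      try abel
    by_cases h4 : k = s + 1
    · rw [h4]
      have e0 := hZ.anti (show i < s by omega) hjt
      have e1 := hZ.anti (show i < s + 1 by omega) hjt
      simp only [rowOp_succ, rowOp_of_ne _ _ _ _ _ _ (show i ≠ s by omega)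
          (show i ≠ s + 1 by omega)]
      simp only [mul_add, add_mul, mul_assoc, smul_mul_assoc, mul_smul_comm, smul_add, smul_smul,
          hA', hB', hD', ab', bd', da', ad', sub_mul, mul_sub, one_mul, smul_sub, e0, e1]
      try abel
    · simp only [rowOp_of_ne _ _ _ _ _ _ h1 h2, rowOp_of_ne _ _ _ _ _ _ h3 h4]
      exact hZ.anti hik hjt
  · by_cases h1 : i = s
    · by_cases h2 : k = s + 1
      · rw [h1, h2]
        have r1 := hZ.row s hjt
        have r2 := hZ.row (s + 1) hjt
        have c1 := hZ.col j hs
        have c2 := hZ.col t hs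
        have a1 := hZ.anti hs hjt
        have x1 := hZ.cross hs hjt
        rw [a1] at x1
        simp only [rowOp_self, rowOp_succ]
        simp only [mul_add, add_mul, mul_assoc, smul_mul_assoc, mul_smul_comm, smul_add, smul_smul,
            hA', hB', hD', ab', bd', da', ad', sub_mul, mul_sub, one_mul, smul_sub, r1, r2, c1, c2,
          a1, x1]
        match_scalars <;> field_simp <;> ring
      · rw [h1]
        have e0 := hZ.cross (show s < k by omega) hjt
        have e1 := hZ.cross (show s + 1 < k by omega) hjt
        simp only [rowOp_self, rowOp_of_ne _ _ _ _ _ _ (show k ≠ s by omega)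
          (show k ≠ s + 1 by omega)]
        simp only [mul_add, add_mul, mul_assoc, smul_mul_assoc, mul_smul_comm, smul_add, smul_smul,
            hA', hB', hD', ab', bd', da', ad', sub_mul, mul_sub, one_mul, smul_sub, e0, e1]
        try abel
    by_cases h2 : i = s + 1
    · rw [h2]
      have e0 := hZ.cross (show s < k by omega) hjt
      have e1 := hZ.cross (show s + 1 < k by omega) hjt
      simp only [rowOp_succ, rowOp_of_ne _ _ _ _ _ _ (show k ≠ s by omega)
          (show k ≠ s + 1 by omega)]
      simp only [mul_add, add_mul, mul_assoc, smul_mul_assoc, mul_smul_comm, smul_add, smul_smul,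
          hA', hB', hD', ab', bd', da', ad', sub_mul, mul_sub, one_mul, smul_sub, e0, e1]
      try abel
    by_cases h3 : k = s
    · rw [h3]
      have e0 := hZ.cross (show i < s by omega) hjt
      have e1 := hZ.cross (show i < s + 1 by omega) hjt
      simp only [rowOp_self, rowOp_of_ne _ _ _ _ _ _ (show i ≠ s by omega)
          (show i ≠ s + 1 by omega)]
      simp only [mul_add, add_mul, mul_assoc, smul_mul_assoc, mul_smul_comm, smul_add, smul_smul,
          hA', hB', hD', ab', bd', da', ad', sub_mul, mul_sub, one_mul, smul_sub, e0, e1]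
      try abel
    by_cases h4 : k = s + 1
    · rw [h4]
      have e0 := hZ.cross (show i < s by omega) hjt
      have e1 := hZ.cross (show i < s + 1 by omega) hjt
      simp only [rowOp_succ, rowOp_of_ne _ _ _ _ _ _ (show i ≠ s by omega)
          (show i ≠ s + 1 by omega)]
      simp only [mul_add, add_mul, mul_assoc, smul_mul_assoc, mul_smul_comm, smul_add, smul_smul,
          hA', hB', hD', ab', bd', da', ad', sub_mul, mul_sub, one_mul, smul_sub, e0, e1]
      try abel
    · simp only [rowOp_of_ne _ _ _ _ _ _ h1 h2, rowOp_of_ne _ _ _ _ _ _ h3 h4]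
      exact hZ.cross hik hjt

end Algebraic

/-! ### The quantum matrix as an iterated product of oscillator blocks. -/

section Chain

variable {𝒜 : Type*} [Ring 𝒜] [Algebra ℂ 𝒜]

/-- The block diagonal matrix `diag(1, Y)`. -/
def border (Y : ℕ → ℕ → 𝒜) : ℕ → ℕ → 𝒜
  | 0, 0 => 1
  | 0, _ + 1 => 0
  | _ + 1, 0 => 0
  | i + 1, j + 1 => Y i j

/-- The matrix `diag(1, Y)` after the first `s` row operations, the `r`-th one acting on the rows
`r`, `r + 1`. -/
def chain (A B D : ℕ → 𝒜) (Y : ℕ → ℕ → 𝒜) : ℕ → ℕ → ℕ → 𝒜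
  | 0 => border Y
  | s + 1 => rowOp s (A s) (B s) (D s) (chain A B D Y s)

/-- The quantum matrix of size `b + 1` built from the oscillators `(c, k)`, `k < c ≤ b`. -/
def qmat (A B D : ℕ → ℕ → 𝒜) : ℕ → ℕ → ℕ → 𝒜
  | 0 => fun i j => if i = 0 ∧ j = 0 then 1 else 0
  | b + 1 => chain (A (b + 1)) (B (b + 1)) (D (b + 1)) (qmat A B D b) (b + 1)

lemma IsQuantumMatrix.border {q : ℂ} {Y : ℕ → ℕ → 𝒜} (h : IsQuantumMatrix q Y) :
    IsQuantumMatrix q (border Y) := by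
  constructor
  · rintro (_ | i) (_ | j) (_ | t) hjt <;> simp_all [_root_.border]
    exact h.row i hjt
  · rintro (_ | i) (_ | s) (_ | j) his <;> simp_all [_root_.border]
    exact h.col j his
  · rintro (_ | i) (_ | s) (_ | j) (_ | t) his hjt <;> simp_all [_root_.border]
    exact h.anti his hjt
  · rintro (_ | i) (_ | s) (_ | j) (_ | t) his hjt <;> simp_all [_root_.border]
    exact h.cross his hjt

variable {A B D : ℕ → 𝒜} {Y : ℕ → ℕ → 𝒜}

lemma chain_of_lt_row {s i : ℕ} (j : ℕ) (h : s < i) : chain A B D Y s i j = border Y i j := by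
  induction s with
  | zero => rfl
  | succ s ih => rw [chain, rowOp_of_ne _ _ _ _ _ _ (by omega) (by omega), ih (by omega)]

/-- Recursion for the active row: after `s` operations, row `s` is the only changed row that the
remaining operations will still mix. -/
lemma chain_succ_self (s j : ℕ) : chain A B D Y (s + 1) (s + 1) j =
    B s * chain A B D Y s s j + D s * border Y (s + 1) j := by
  rw [chain, rowOp_succ, chain_of_lt_row _ (Nat.lt_succ_self s)]

/-- Row `i` is final once operation `i` has been applied, so it is expressed by the active row `i`
at that moment. -/
lemma chain_of_row_lt {s i : ℕ} (j : ℕ) (h : i < s) : chain A B D Y s i j =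
    A i * chain A B D Y i i j + B i * border Y (i + 1) j := by
  induction s with
  | zero => omega
  | succ s ih =>
    rcases Nat.lt_succ_iff_lt_or_eq.mp h with h | rfl
    · rw [chain, rowOp_of_ne _ _ _ _ _ _ (by omega) (by omega), ih h]
    · rw [chain, rowOp_self, chain_of_lt_row _ (Nat.lt_succ_self i)]

lemma commute_border {c : 𝒜} (hY : ∀ i j, Commute (Y i j) c) (i j : ℕ) :
    Commute (border Y i j) c := by
  rcases i with _ | i <;> rcases j with _ | j <;> simp [border, hY]

lemma commute_chain {c : 𝒜} {s : ℕ} (hY : ∀ i j, Commute (Y i j) c)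
    (hA : ∀ r < s, Commute (A r) c) (hB : ∀ r < s, Commute (B r) c)
    (hD : ∀ r < s, Commute (D r) c) (i j : ℕ) : Commute (chain A B D Y s i j) c := by
  induction s generalizing i j with
  | zero => exact commute_border hY i j
  | succ s ih =>
    have ih := ih (fun r hr => hA r (by omega)) (fun r hr => hB r (by omega))
      (fun r hr => hD r (by omega))
    have h1 := hA s (by omega)
    have h2 := hB s (by omega)
    have h3 := hD s (by omega)
    rw [chain, rowOp]
    split_ifs
    · exact (h1.mul_left (ih _ _)).add_left (h2.mul_left (ih _ _))
    · exact (h2.mul_left (ih _ _)).add_left (h3.mul_left (ih _ _))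
    · exact ih _ _

lemma IsQuantumMatrix.chain {q : ℂ} (hq : q ≠ 0) (hY : IsQuantumMatrix q Y) {s : ℕ}
    (hosc : ∀ r < s, IsOscillator q (A r) (B r) (D r))
    (hYc : ∀ r < s, ∀ x ∈ ({A r, B r, D r} : Set 𝒜), ∀ i j, Commute (Y i j) x)
    (hc : ∀ r < s, ∀ r' < s, r ≠ r' → ∀ x ∈ ({A r, B r, D r} : Set 𝒜),
      ∀ y ∈ ({A r', B r', D r'} : Set 𝒜), Commute x y) :
    IsQuantumMatrix q (chain A B D Y s) := by
  induction s with
  | zero => exact hY.border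
  | succ s ih =>
    have key : ∀ x ∈ ({A s, B s, D s} : Set 𝒜), ∀ i j,
        Commute (_root_.chain A B D Y s i j) x := fun x hx i j =>
      commute_chain (hYc s (by omega) x hx)
        (fun r hr => hc r (by omega) s (by omega) (by omega) _ (by simp) _ hx)
        (fun r hr => hc r (by omega) s (by omega) (by omega) _ (by simp) _ hx)
        (fun r hr => hc r (by omega) s (by omega) (by omega) _ (by simp) _ hx) i j
    exact (ih (fun r hr => hosc r (by omega)) (fun r hr => hYc r (by omega))
      (fun r hr r' hr' => hc r (by omega) r' (by omega))).rowOp hq (hosc s (by omega)) s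
      (fun i j => key _ (by simp) i j) (fun i j => key _ (by simp) i j)
      (fun i j => key _ (by simp) i j)

end Chain

/-- Pairwise commuting oscillators indexed by the pairs `k < b ≤ N`. -/
structure IsOscillatorSystem {𝒜 : Type*} [Ring 𝒜] [Algebra ℂ 𝒜] (q : ℂ) (N : ℕ)
    (A B D : ℕ → ℕ → 𝒜) : Prop where
  osc : ∀ b k, k < b → b ≤ N → IsOscillator q (A b k) (B b k) (D b k)
  comm : ∀ b k c r, k < b → b ≤ N → r < c → c ≤ N → (b ≠ c ∨ k ≠ r) →
    ∀ x ∈ ({A b k, B b k, D b k} : Set 𝒜), ∀ y ∈ ({A c r, B c r, D c r} : Set 𝒜), Commute x y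

namespace IsOscillatorSystem

variable {𝒜 : Type*} [Ring 𝒜] [Algebra ℂ 𝒜] {q : ℂ} {N : ℕ} {A B D : ℕ → ℕ → 𝒜}

lemma commute_qmat (h : IsOscillatorSystem q N A B D) {b c r : ℕ} (hbc : b < c) (hr : r < c)
    (hc : c ≤ N) (x : 𝒜) (hx : x ∈ ({A c r, B c r, D c r} : Set 𝒜)) (i j : ℕ) :
    Commute (qmat A B D b i j) x := by
  induction b generalizing i j with
  | zero =>
    simp only [qmat]
    split_ifs <;> simp
  | succ b ih =>
    exact commute_chain (ih (by omega))
      (fun k hk => h.comm _ _ _ _ hk (by omega) hr hc (by omega) _ (by simp) _ hx)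
      (fun k hk => h.comm _ _ _ _ hk (by omega) hr hc (by omega) _ (by simp) _ hx)
      (fun k hk => h.comm _ _ _ _ hk (by omega) hr hc (by omega) _ (by simp) _ hx) i j

lemma isQuantumMatrix (h : IsOscillatorSystem q N A B D) (hq : q ≠ 0) {b : ℕ} (hb : b ≤ N) :
    IsQuantumMatrix q (qmat A B D b) := by
  induction b with
  | zero =>
    constructor <;> intros <;> simp only [qmat] <;> split_ifs <;> first | omega | simp
  | succ b ih =>
    exact (ih (by omega)).chain hq (fun r hr => h.osc _ _ hr hb)
      (fun r hr x hx => h.commute_qmat (Nat.lt_succ_self b) hr hb x hx)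
      (fun r hr r' hr' hne => h.comm _ _ _ _ hr hb hr' hb (Or.inr hne))

/-- The entry `(i, j)` of `qmat b` is homogeneous of weight `ε i - ε (b - j)` if the
creation operators `(c, k)` have weight `ε k - ε c`. -/
lemma _root_.qmat_mem {Γ : Type*} [AddCommGroup Γ] (G : Γ → AddSubmonoid 𝒜) (h1 : (1 : 𝒜) ∈ G 0)
    (hmul : ∀ u v : Γ, ∀ x ∈ G u, ∀ y ∈ G v, x * y ∈ G (u + v)) (ε : ℕ → Γ)
    (hA : ∀ c k, k < c → c ≤ N → A c k ∈ G (ε k - ε c))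
    (hB : ∀ c k, k < c → c ≤ N → B c k ∈ G 0)
    (hD : ∀ c k, k < c → c ≤ N → D c k ∈ G (ε c - ε k)) {b : ℕ} (hb : b ≤ N) {i j : ℕ}
    (hi : i ≤ b) (hj : j ≤ b) : qmat A B D b i j ∈ G (ε i - ε (b - j)) := by
  induction b generalizing i j with
  | zero =>
    obtain rfl : i = 0 := by omega
    obtain rfl : j = 0 := by omega
    simpa [qmat] using h1
  | succ b ih =>
    have hmul' : ∀ {u v w : Γ}, u + v = w → ∀ {x y : 𝒜}, x ∈ G u → y ∈ G v → x * y ∈ G w := by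
      rintro u v w rfl x y hx hy
      exact hmul u v x hx y hy
    have hbord : ∀ i ≤ b, border (qmat A B D b) (i + 1) j ∈ G (ε i - ε (b + 1 - j)) := by
      intro i hi
      rcases j with _ | j
      · exact zero_mem _
      · rw [Nat.add_sub_add_right]
        exact ih (by omega) hi (by omega)
    -- The active row has the weight of row `b + 1` at every stage `s`: the weight of `D` cancels
    -- that of the row it absorbs.
    have hact : ∀ s ≤ b + 1, chain (A (b + 1)) (B (b + 1)) (D (b + 1)) (qmat A B D b) s s j ∈
        G (ε (b + 1) - ε (b + 1 - j)) := by
      intro s hs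
      induction s with
      | zero =>
        rcases j with _ | j
        · simpa [chain, border] using h1
        · exact zero_mem _
      | succ s ih' =>
        rw [chain_succ_self]
        refine add_mem (hmul' (by abel) (hB _ _ (by omega) hb) (ih' (by omega)))
          (hmul' ?_ (hD _ _ (by omega) hb) (hbord s (by omega)))
        abel
    rw [qmat]
    rcases hi.lt_or_eq with hi | rfl
    · rw [chain_of_row_lt _ hi]
      refine add_mem (hmul' ?_ (hA _ _ hi hb) (hact i (by omega)))
        (hmul' ?_ (hB _ _ hi hb) (hbord i (by omega))) <;> abel
    · exact hact _ le_rfl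

end IsOscillatorSystem

/-! ### Action on vectors -/

section Vectors

variable {V : Type*} [AddCommGroup V] [Module ℂ V]

/-- The first `n` rows of a matrix of operators are independent on vectors of `V`. -/
def RowsIndependent (n : ℕ) (Z : ℕ → ℕ → Module.End ℂ V) : Prop :=
  ∀ w : ℕ → V, (∀ j, ∑ i ∈ Finset.range n, Z i j (w i) = 0) → ∀ i < n, w i = 0

/-- The block is invertible on the left up to `B`: since `D A - q⁻¹ B²` is the scalar `-q`,
eliminating `y` from the two equations leaves `q x = 0`. -/
lemma IsOscillator.eq_zero_of_eq_zero {q : ℂ} (hq : q ≠ 0) {A B D : Module.End ℂ V}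
    (h : IsOscillator q A B D) (hB : ∀ f, B f = 0 → f = 0) {x y : V}
    (h1 : A x + B y = 0) (h2 : B x + D y = 0) : x = 0 ∧ y = 0 := by
  have e1 : D (A x) = q⁻¹ • B (B x) - q • x := by simpa using DFunLike.congr_fun h.da x
  have e2 : B (D y) = q • D (B y) := by simpa using DFunLike.congr_fun h.bd y
  have e3 : D (A x) + D (B y) = 0 := by rw [← map_add, h1, map_zero]
  have e4 : B (B x) + B (D y) = 0 := by rw [← map_add, h2, map_zero]
  have hx : x = 0 := by
    have : q • x = 0 := by
      calc q • x = q⁻¹ • (B (B x) + B (D y)) - (D (A x) + D (B y)) := by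
            rw [e1, e2]
            match_scalars <;> field_simp <;> ring
        _ = 0 := by rw [e3, e4]; simp
    exact (smul_eq_zero.mp this).resolve_left hq
  refine ⟨hx, hB _ ?_⟩
  simpa [hx] using h1

lemma RowsIndependent.border {n : ℕ} {Y : ℕ → ℕ → Module.End ℂ V} (h : RowsIndependent n Y) :
    RowsIndependent (n + 1) (border Y) := by
  intro w hw i hi
  have h0 := hw 0
  rw [Finset.sum_range_succ'] at h0
  rcases i with _ | i
  · simpa [_root_.border] using h0
  · refine h (fun i => w (i + 1)) (fun j => ?_) i (by omega)
    simpa [Finset.sum_range_succ', _root_.border] using hw (j + 1)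

/-- The block is symmetric and commutes with the entries, so it can be moved onto the vectors: a
relation with coefficients `w` among the new rows is one with coefficients `w'` among the old rows.
-/
lemma RowsIndependent.rowOp {n s : ℕ} {Z : ℕ → ℕ → Module.End ℂ V} (h : RowsIndependent n Z)
    {q : ℂ} (hq : q ≠ 0) {A B D : Module.End ℂ V} (hosc : IsOscillator q A B D)
    (hinj : ∀ f, B f = 0 → f = 0) (hs : s + 1 < n) (hA : ∀ i j, Commute (Z i j) A)
    (hB : ∀ i j, Commute (Z i j) B) (hD : ∀ i j, Commute (Z i j) D) :
    RowsIndependent n (rowOp s A B D Z) := by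
  intro w hw
  set w' : ℕ → V := fun i =>
    if i = s then A (w s) + B (w (s + 1)) else if i = s + 1 then B (w s) + D (w (s + 1))
    else w i with hw'
  have key : ∀ i < n, w' i = 0 := by
    refine h w' fun j => ?_
    rw [← hw j, ← sub_eq_zero, ← Finset.sum_sub_distrib,
      Finset.sum_eq_add_of_mem s (s + 1) (by simp; omega) (by simp; omega) (by omega)]
    · have eA := fun i x => DFunLike.congr_fun (hA i j).eq x
      have eB := fun i x => DFunLike.congr_fun (hB i j).eq x
      have eD := fun i x => DFunLike.congr_fun (hD i j).eq x
      simp only [Module.End.mul_apply] at eA eB eD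
      simp [hw', rowOp_self, rowOp_succ, eA, eB, eD]
    · rintro c - ⟨h1, h2⟩
      simp [hw', h1, h2, rowOp_of_ne]
  have k1 := key s (by omega)
  have k2 := key (s + 1) hs
  simp only [hw', if_true, Nat.succ_ne_self, if_false] at k1 k2
  obtain ⟨hx, hy⟩ := hosc.eq_zero_of_eq_zero hq hinj k1 k2
  intro i hi
  by_cases h1 : i = s
  · rw [h1, hx]
  by_cases h2 : i = s + 1
  · rw [h2, hy]
  simpa [hw', h1, h2] using key i hi

variable {q : ℂ} {N : ℕ} {A B D : ℕ → ℕ → Module.End ℂ V}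

namespace IsOscillatorSystem

lemma rowsIndependent (h : IsOscillatorSystem q N A B D) (hq : q ≠ 0)
    (hinj : ∀ b k, k < b → b ≤ N → ∀ f, B b k f = 0 → f = 0) {b : ℕ} (hb : b ≤ N) :
    RowsIndependent (b + 1) (qmat A B D b) := by
  induction b with
  | zero =>
    intro w hw i hi
    obtain rfl : i = 0 := by omega
    simpa [qmat] using hw 0
  | succ b ih =>
    have key : ∀ s ≤ b + 1, RowsIndependent (b + 2)
        (chain (A (b + 1)) (B (b + 1)) (D (b + 1)) (qmat A B D b) s) := by
      intro s hs
      induction s with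
      | zero => exact (ih (by omega)).border
      | succ s ihs =>
        have hcomm : ∀ x ∈ ({A (b + 1) s, B (b + 1) s, D (b + 1) s} : Set (Module.End ℂ V)),
            ∀ i j, Commute (chain (A (b + 1)) (B (b + 1)) (D (b + 1)) (qmat A B D b) s i j) x :=
          fun x hx => commute_chain
            (h.commute_qmat (Nat.lt_succ_self b) (by omega) hb x hx)
            (fun r hr => h.comm (b + 1) r (b + 1) s (by omega) hb (by omega) hb (by omega) _
              (by simp) _ hx)
            (fun r hr => h.comm (b + 1) r (b + 1) s (by omega) hb (by omega) hb (by omega) _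
              (by simp) _ hx)
            (fun r hr => h.comm (b + 1) r (b + 1) s (by omega) hb (by omega) hb (by omega) _
              (by simp) _ hx)
        exact (ihs (by omega)).rowOp hq (h.osc _ _ (by omega) hb) (hinj _ _ (by omega) hb)
          (by omega) (hcomm _ (by simp)) (hcomm _ (by simp)) (hcomm _ (by simp))
    exact key _ le_rfl

/-- In the recursion for the active row, every entry outside column `0` is a sum of terms containing
some `D`, which commutes past the smaller matrix and hits `f`. -/
lemma active_apply_eq_zero (h : IsOscillatorSystem q N A B D) {b s : ℕ} (hb : b + 1 ≤ N)
    (hs : s ≤ b + 1) {f : V} (hf : ∀ k < s, D (b + 1) k f = 0) (j : ℕ) :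
    chain (A (b + 1)) (B (b + 1)) (D (b + 1)) (qmat A B D b) s s (j + 1) f = 0 := by
  induction s with
  | zero => simp [chain, border]
  | succ s ih =>
    have := DFunLike.congr_fun (h.commute_qmat (Nat.lt_succ_self b) (show s < b + 1 by omega) hb
      (D (b + 1) s) (by simp) s j).eq f
    simp only [Module.End.mul_apply] at this
    rw [chain_succ_self, LinearMap.add_apply, Module.End.mul_apply,
      ih (by omega) (fun k hk => hf k (by omega)), map_zero, Module.End.mul_apply, border, ← this,
      hf s (by omega), map_zero, add_zero]

lemma qmat_succ_apply (h : IsOscillatorSystem q N A B D) {b i : ℕ} (hb : b + 1 ≤ N)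
    (hi : i ≤ b) {f : V} (hf : ∀ k < b + 1, D (b + 1) k f = 0) (j : ℕ) :
    qmat A B D (b + 1) i (j + 1) f = B (b + 1) i (qmat A B D b i j f) := by
  rw [qmat, chain_of_row_lt _ (by omega), LinearMap.add_apply, Module.End.mul_apply,
    h.active_apply_eq_zero hb (by omega) (fun k hk => hf k (by omega)), map_zero, zero_add]
  rfl

/-- On vectors annihilated at all levels above `b`, each higher level only shifts the column by one
and multiplies by its injective weight operator. This reduces questions about the full matrix to
level `b`; `U` is the product of these weight operators. -/
lemma exists_factor (h : IsOscillatorSystem q N A B D)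
    (hinj : ∀ b k, k < b → b ≤ N → ∀ f, B b k f = 0 → f = 0) {b i M : ℕ} (hi : i ≤ b)
    (hbM : b ≤ M) (hM : M ≤ N) :
    ∃ U : Module.End ℂ V, (∀ f, U f = 0 → f = 0) ∧
      (∀ f, (∀ c, b < c → c ≤ M → B c i f = f) → U f = f) ∧
      ∀ j f, (∀ c k, b < c → c ≤ M → k < c → D c k f = 0) →
        qmat A B D M i (M - b + j) f = U (qmat A B D b i j f) := by
  induction M, hbM using Nat.le_induction with
  | base => exact ⟨1, fun f hf => hf, fun f _ => rfl, fun j f _ => by simp⟩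
  | succ M hbM ih =>
    obtain ⟨U, h1, h2, h3⟩ := ih (by omega)
    refine ⟨B (M + 1) i * U, fun f hf => h1 _ (hinj _ _ (by omega) hM _ hf), fun f hf => ?_,
      fun j f hf => ?_⟩
    · rw [Module.End.mul_apply, h2 f (fun c hc hc' => hf c hc (by omega)),
        hf _ (by omega) le_rfl]
    · rw [show M + 1 - b + j = M - b + j + 1 by omega,
        h.qmat_succ_apply hM (by omega) (fun k hk => hf _ _ (by omega) le_rfl hk),
        h3 j f (fun c k hc hc' => hf c k hc (by omega))]
      rfl

/-- Unrolling the recursion, `g k` is `D (b + 1) k f` multiplied by the later weight operators;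
these are injective, so `g k = 0` still detects annihilation. Independence of the rows of the
smaller matrix can then be applied. -/
lemma exists_active_eq_sum (h : IsOscillatorSystem q N A B D)
    (hinj : ∀ b k, k < b → b ≤ N → ∀ f, B b k f = 0 → f = 0) {b s : ℕ} (hb : b + 1 ≤ N)
    (hs : s ≤ b + 1) (f : V) : ∃ g : ℕ → V, (∀ k < s, g k = 0 → D (b + 1) k f = 0) ∧
      ∀ j, chain (A (b + 1)) (B (b + 1)) (D (b + 1)) (qmat A B D b) s s (j + 1) f =
        ∑ k ∈ Finset.range s, qmat A B D b k j (g k) := by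
  induction s with
  | zero => exact ⟨0, by simp, by simp [chain, border]⟩
  | succ s ih =>
    obtain ⟨g, h1, h2⟩ := ih (by omega)
    have hc : ∀ x ∈ ({A (b + 1) s, B (b + 1) s, D (b + 1) s} : Set (Module.End ℂ V)), ∀ i j v,
        qmat A B D b i j (x v) = x (qmat A B D b i j v) := fun x hx i j v =>
      DFunLike.congr_fun
        (h.commute_qmat (Nat.lt_succ_self b) (show s < b + 1 by omega) hb x hx i j).eq v
    refine ⟨fun k => if k = s then D (b + 1) s f else B (b + 1) s (g k), fun k hk hg => ?_,
      fun j => ?_⟩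
    · by_cases hks : k = s
      · simpa [hks] using hg
      · exact h1 k (by omega) (hinj (b + 1) s (by omega) hb _ (by simpa [hks] using hg))
    · rw [chain_succ_self, LinearMap.add_apply, Module.End.mul_apply, h2, Finset.sum_range_succ,
        Module.End.mul_apply, border, map_sum]
      simp only [if_true]
      rw [hc _ (by simp)]
      refine congrArg₂ _ (Finset.sum_congr rfl fun k hk => ?_) rfl
      rw [if_neg (Finset.mem_range.mp hk).ne, hc _ (by simp)]

/-- If the last row of the matrix, up to its first entry, kills a vector, then the oscillators of
the last level annihilate it. -/
lemma annihilation_eq_zero (h : IsOscillatorSystem q N A B D) (hq : q ≠ 0)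
    (hinj : ∀ b k, k < b → b ≤ N → ∀ f, B b k f = 0 → f = 0) {b : ℕ} (hb : b + 1 ≤ N) {f : V}
    (hf : ∀ j, qmat A B D (b + 1) (b + 1) (j + 1) f = 0) {k : ℕ} (hk : k < b + 1) :
    D (b + 1) k f = 0 := by
  obtain ⟨g, h1, h2⟩ := h.exists_active_eq_sum hinj hb le_rfl f
  exact h1 k hk (h.rowsIndependent hq hinj (by omega) g (fun j => by rw [← h2]; exact hf j) k hk)

end IsOscillatorSystem
end Vectors

section Column

variable {𝒜 : Type*} [Ring 𝒜] [Algebra ℂ 𝒜]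

lemma chain_succ_self_zero (A B D : ℕ → 𝒜) (Y : ℕ → ℕ → 𝒜) (s : ℕ) :
    chain A B D Y (s + 1) (s + 1) 0 = B s * chain A B D Y s s 0 := by
  simp [chain_succ_self, border]

lemma qmat_succ_zero (A B D : ℕ → ℕ → 𝒜) {b i : ℕ} (hi : i ≤ b) :
    qmat A B D (b + 1) i 0 = A (b + 1) i *
      chain (A (b + 1)) (B (b + 1)) (D (b + 1)) (qmat A B D b) i i 0 := by
  rw [qmat, chain_of_row_lt _ (by omega)]
  simp [border]

end Column

/-! ### Operators acting on one tensor factor -/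

section Lift

variable {S : Type*} [DecidableEq S] {F : S → Type*} [∀ p, Fintype (F p)]
  [∀ p, DecidableEq (F p)]

/-- The operator given by a matrix acting on the coordinate `p`. -/
def liftAt (p : S) : Matrix (F p) (F p) ℂ →ₐ[ℂ] Module.End ℂ ((∀ p, F p) → ℂ) :=
  AlgHom.ofLinearMap
    { toFun := fun M =>
        { toFun := fun f α => ∑ k, M (α p) k * f (Function.update α p k)
          map_add' := fun f g => by
            funext α
            simp [mul_add, Finset.sum_add_distrib]
          map_smul' := fun c f => by
            funext α
            simp [Finset.mul_sum, mul_left_comm] }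
      map_add' := fun M M' => by
        ext f α
        simp [add_mul, Finset.sum_add_distrib]
      map_smul' := fun c M => by
        ext f α
        simp [Finset.mul_sum, mul_assoc] }
    (by
      ext f α
      simp [Matrix.one_apply])
    (fun M M' => by
      refine LinearMap.ext fun f => funext fun α => ?_
      simp only [LinearMap.coe_mk, AddHom.coe_mk, Module.End.mul_apply, Matrix.mul_apply,
        Function.update_self, Function.update_idem, Finset.sum_mul, Finset.mul_sum, mul_assoc]
      exact Finset.sum_comm)

lemma liftAt_apply (p : S) (M : Matrix (F p) (F p) ℂ) (f : (∀ p, F p) → ℂ) (α : ∀ p, F p) :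
    liftAt p M f α = ∑ k, M (α p) k * f (Function.update α p k) := rfl

lemma commute_liftAt {p p' : S} (h : p ≠ p') (M : Matrix (F p) (F p) ℂ)
    (M' : Matrix (F p') (F p') ℂ) : Commute (liftAt p M) (liftAt p' M') := by
  refine LinearMap.ext fun f => funext fun α => ?_
  simp only [Module.End.mul_apply, liftAt_apply, Finset.mul_sum,
    Function.update_of_ne h, Function.update_of_ne h.symm]
  rw [Finset.sum_comm]
  refine Finset.sum_congr rfl fun k _ => Finset.sum_congr rfl fun l _ => ?_
  rw [Function.update_comm h, mul_left_comm]

variable [Fintype S]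

lemma liftAt_single (p : S) (M : Matrix (F p) (F p) ℂ) (α : ∀ p, F p) :
    liftAt p M (Pi.single α 1) =
      ∑ k, M k (α p) • (Pi.single (Function.update α p k) 1 : (∀ p, F p) → ℂ) := by
  funext β
  rw [liftAt_apply, Finset.sum_apply]
  by_cases h : ∃ k, Function.update β p k = α
  · obtain ⟨k, rfl⟩ := h
    rw [Finset.sum_eq_single k, Finset.sum_eq_single (β p)]
    · simp
    · intro l _ hl
      rw [Pi.smul_apply, Pi.single_eq_of_ne, smul_zero]
      intro h
      exact hl (by simpa using (congrFun h p).symm)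
    · simp
    · intro l _ hl
      rw [Pi.single_eq_of_ne, mul_zero]
      intro h
      exact hl (by simpa using congrFun h p)
    · simp
  · push Not at h
    rw [Finset.sum_eq_zero, Finset.sum_eq_zero]
    · intro l _
      rw [Pi.smul_apply, Pi.single_eq_of_ne, smul_zero]
      rintro rfl
      exact h (α p) (by simp)
    · intro l _
      rw [Pi.single_eq_of_ne (h l), mul_zero]

/-- The diagonal operator with the given eigenvalues. -/
def diagOp {ι : Type*} (τ : ι → ℂ) : Module.End ℂ (ι → ℂ) where
  toFun f α := τ α * f α
  map_add' f g := by
    funext α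
    simp [mul_add]
  map_smul' c f := by
    funext α
    simp [mul_left_comm]

lemma diagOp_apply {ι : Type*} (τ : ι → ℂ) (f : ι → ℂ) (α : ι) :
    diagOp τ f α = τ α * f α := rfl

lemma diagOp_mul {ι : Type*} (τ τ' : ι → ℂ) : diagOp τ * diagOp τ' = diagOp (τ * τ') := by
  ext f α
  simp [diagOp_apply, mul_assoc]

lemma diagOp_single {ι : Type*} [DecidableEq ι] (τ : ι → ℂ) (α : ι) :
    diagOp τ (Pi.single α 1) = τ α • Pi.single α 1 := by
  funext β
  rw [diagOp_apply, Pi.smul_apply, smul_eq_mul]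
  by_cases h : β = α
  · rw [h]
  · simp [h]

lemma sum_update {Γ : Type*} [AddCommGroup Γ] (w : ∀ p, F p → Γ) (α : ∀ p, F p) (p : S)
    (k : F p) : ∑ p', w p' (Function.update α p k p') = ∑ p', w p' (α p') + w p k - w p (α p) := by
  rw [← Finset.add_sum_erase _ _ (Finset.mem_univ p),
    ← Finset.add_sum_erase (f := fun p' => w p' (α p')) _ (Finset.mem_univ p),
    Finset.sum_congr rfl fun p' hp' => by rw [Function.update_of_ne (Finset.ne_of_mem_erase hp')]]
  simp
  abel

/-- Operators raising the degree of functions by at most `s`. -/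
def shiftAtMost {ι : Type*} (deg : ι → ℤ) (s : ℤ) : AddSubmonoid (Module.End ℂ (ι → ℂ)) where
  carrier := {X | ∀ (d : ℤ) (f : ι → ℂ), (∀ α, f α ≠ 0 → deg α ≤ d) →
    ∀ α, X f α ≠ 0 → deg α ≤ d + s}
  zero_mem' := fun d f _ α h => by simp at h
  add_mem' := fun {X Y} hX hY d f hf α h => by
    by_cases hx : X f α = 0
    · refine hY d f hf α fun hy => h ?_
      simp [hx, hy]
    · exact hX d f hf α hx

lemma mul_mem_shiftAtMost {ι : Type*} (deg : ι → ℤ) (s t : ℤ) :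
    ∀ X ∈ shiftAtMost deg s, ∀ Y ∈ shiftAtMost deg t, X * Y ∈ shiftAtMost deg (s + t) := by
  intro X hX Y hY d f hf α h
  have := hX (d + t) (Y f) (hY d f hf) α h
  omega

lemma diagOp_mem_shiftAtMost {ι : Type*} (deg : ι → ℤ) (τ : ι → ℂ) :
    diagOp τ ∈ shiftAtMost deg 0 := by
  intro d f hf α h
  rw [add_zero]
  exact hf α fun h0 => h (by rw [diagOp_apply, h0, mul_zero])

lemma liftAt_mem_shiftAtMost (w : ∀ p, F p → ℤ) (p : S) (M : Matrix (F p) (F p) ℂ) (s : ℤ)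
    (h : ∀ r k, M r k ≠ 0 → w p r ≤ w p k + s) :
    liftAt p M ∈ shiftAtMost (fun α : ∀ p, F p => ∑ p, w p (α p)) s := by
  intro d f hf α hα
  rw [liftAt_apply] at hα
  obtain ⟨k, -, hk⟩ := Finset.exists_ne_zero_of_sum_ne_zero hα
  have h1 := hf _ (right_ne_zero_of_mul hk)
  have h2 := h _ _ (left_ne_zero_of_mul hk)
  simp only [sum_update] at h1
  show ∑ p, w p (α p) ≤ d + s
  omega

/-- Operators commuting with `T` up to a given scalar. -/
def commutingUpTo {V : Type*} [AddCommGroup V] [Module ℂ V] (T : Module.End ℂ V)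
    (u : Additive ℂˣ) : AddSubmonoid (Module.End ℂ V) where
  carrier := {X | T * X = (u.toMul : ℂ) • (X * T)}
  zero_mem' := by simp
  add_mem' := fun {X Y} hX hY => by
    simp only [Set.mem_ofPred_eq] at *
    rw [mul_add, hX, hY, add_mul, smul_add]

lemma mem_commutingUpTo {V : Type*} [AddCommGroup V] [Module ℂ V] {T X : Module.End ℂ V}
    {u : Additive ℂˣ} : X ∈ commutingUpTo T u ↔ T * X = (u.toMul : ℂ) • (X * T) := Iff.rfl

lemma mul_mem_commutingUpTo {V : Type*} [AddCommGroup V] [Module ℂ V] (T : Module.End ℂ V)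
    (u v : Additive ℂˣ) :
    ∀ X ∈ commutingUpTo T u, ∀ Y ∈ commutingUpTo T v, X * Y ∈ commutingUpTo T (u + v) := by
  intro X hX Y hY
  rw [mem_commutingUpTo] at *
  rw [← mul_assoc, hX, smul_mul_assoc, mul_assoc, hY, mul_smul_comm, smul_smul, mul_assoc]
  simp

lemma prod_update (ρ : S → ℂˣ) (e : ∀ p, F p → ℕ) (α : ∀ p, F p) (p : S) (k : F p) :
    (∏ p', ρ p' ^ e p' (Function.update α p k p')) * ρ p ^ e p (α p) =
      (∏ p', ρ p' ^ e p' (α p')) * ρ p ^ e p k := by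
  have := sum_update (Γ := Additive ℂˣ) (fun p k => Additive.ofMul (ρ p ^ e p k)) α p k
  apply_fun Additive.toMul at this
  simp only [toMul_sum, toMul_sub, toMul_add, toMul_ofMul] at this
  rw [this, div_mul_cancel]

lemma liftAt_mem_commutingUpTo (ρ : S → ℂˣ) (e : ∀ p, F p → ℕ) (p : S)
    (M : Matrix (F p) (F p) ℂ) (u : ℂˣ)
    (h : ∀ r k, M r k ≠ 0 → ρ p ^ e p r = u * ρ p ^ e p k) :
    liftAt p M ∈ commutingUpTo
      (diagOp fun α : ∀ p, F p => ((∏ p, ρ p ^ e p (α p) : ℂˣ) : ℂ)) (Additive.ofMul u) := by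
  rw [mem_commutingUpTo]
  refine LinearMap.ext fun f => funext fun α => ?_
  simp only [Module.End.mul_apply, diagOp_apply, liftAt_apply, LinearMap.smul_apply,
    Pi.smul_apply, smul_eq_mul, Finset.mul_sum]
  refine Finset.sum_congr rfl fun k _ => ?_
  by_cases hM : M (α p) k = 0
  · simp [hM]
  have h1 := prod_update ρ e α p k
  rw [h _ _ hM] at h1
  have h2 : (∏ p', ρ p' ^ e p' (α p')) =
      u * ∏ p', ρ p' ^ e p' (Function.update α p k p') := by
    apply mul_right_cancel (b := ρ p ^ e p k)
    rw [← h1, mul_left_comm, mul_assoc]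
  rw [h2, Units.val_mul, toMul_ofMul]
  ring

end Lift

/-! ### The oscillator matrices -/

section Matrices

/-- The creation matrix; the last basis vector is sent to `c` times the first one. -/
def creationMatrix (ℓ : ℕ) (c : ℂ) : Matrix (Fin ℓ) (Fin ℓ) ℂ := Matrix.of fun r s =>
  if (s : ℕ) + 1 = r then 1 else if (r : ℕ) = 0 ∧ (s : ℕ) + 1 = ℓ then c else 0

/-- The weight matrix. -/
def weightMatrix (ℓ : ℕ) (q : ℂ) : Matrix (Fin ℓ) (Fin ℓ) ℂ :=
  Matrix.diagonal fun r => q⁻¹ ^ (r : ℕ)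

/-- The annihilation matrix. -/
def annihilationMatrix (ℓ : ℕ) (q : ℂ) : Matrix (Fin ℓ) (Fin ℓ) ℂ := Matrix.of fun r s =>
  if (r : ℕ) + 1 = s then q * q⁻¹ ^ (2 * (s : ℕ)) - q else 0

/-- The relations of the infinite oscillator survive truncation to `ℓ` vectors under two conditions:
`q ^ (2 * ℓ) = 1` makes `D A` vanish on the last vector, and `c * q ^ ℓ = c` makes the wrap-around
entry compatible with the weights. -/
lemma isOscillator_matrix {ℓ : ℕ} {q c : ℂ} (hq : q ≠ 0) (h2 : q ^ (2 * ℓ) = 1)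
    (hc : c * q ^ ℓ = c) : IsOscillator q (creationMatrix ℓ c) (weightMatrix ℓ q)
      (annihilationMatrix ℓ q) := by
  refine ⟨?_, ?_, ?_, ?_⟩
  · ext r s
    simp only [weightMatrix, creationMatrix, Matrix.mul_diagonal, Matrix.smul_apply,
      Matrix.diagonal_mul, Matrix.of_apply, smul_eq_mul]
    split_ifs with h1 h3
    · rw [← h1, pow_succ]
      field_simp
    · obtain ⟨h3, h4⟩ := h3
      rw [← h4, pow_succ] at hc
      rw [h3, inv_pow]
      field_simp
      linear_combination -hc
    · simp
  · ext r s
    simp only [weightMatrix, annihilationMatrix, Matrix.mul_diagonal, Matrix.smul_apply,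
      Matrix.diagonal_mul, Matrix.of_apply, smul_eq_mul]
    split_ifs with h1
    · rw [← h1, pow_succ q⁻¹ r]
      field_simp
    · simp
  · ext r s
    rw [Matrix.mul_apply]
    have hr := r.2
    have hs := s.2
    simp only [weightMatrix, annihilationMatrix, creationMatrix, Matrix.diagonal_mul_diagonal,
      Matrix.sub_apply, Matrix.smul_apply, Matrix.of_apply, smul_eq_mul]
    by_cases hrs : r = s
    · subst hrs
      by_cases hl : (r : ℕ) + 1 < ℓ
      · rw [Finset.sum_eq_single ⟨r + 1, hl⟩]
        · simp
          field_simp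
          ring
        · intro k _ hk
          rw [if_neg (fun h => hk (Fin.ext (by simp; omega))), zero_mul]
        · simp
      · rw [Finset.sum_eq_zero]
        · have hl : ℓ = r + 1 := by omega
          simp
          rw [hl] at h2
          field_simp
          rw [show q ^ (2 * ((r : ℕ) + 1)) = (q ^ (r : ℕ)) ^ 2 * q ^ 2 by ring] at h2
          linear_combination h2
        · intro k _
          rw [if_neg (by omega), zero_mul]
    · rw [Finset.sum_eq_zero]
      · simp [Matrix.diagonal_apply_ne _ hrs, Matrix.one_apply_ne hrs]
      · intro k _
        have : (r : ℕ) ≠ s := fun h => hrs (Fin.ext h)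
        split_ifs <;> first | omega | simp
  · ext r s
    rw [Matrix.mul_apply]
    have hr := r.2
    have hs := s.2
    simp only [weightMatrix, annihilationMatrix, creationMatrix, Matrix.diagonal_mul_diagonal,
      Matrix.sub_apply, Matrix.smul_apply, Matrix.of_apply, smul_eq_mul]
    by_cases hrs : r = s
    · subst hrs
      by_cases hl : 0 < (r : ℕ)
      · rw [Finset.sum_eq_single ⟨r - 1, by omega⟩]
        · rw [if_pos (by simp; omega), if_pos (by simp; omega)]
          simp [two_mul, pow_add]
        · intro k _ hk
          by_cases h0 : (k : ℕ) + 1 = r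
          · exact absurd (Fin.ext (by simp; omega)) hk
          · rw [if_neg h0, if_neg (by omega), zero_mul]
        · simp
      · rw [Finset.sum_eq_zero]
        · have hl : (r : ℕ) = 0 := by omega
          simp [hl]
        · intro k _
          rw [if_neg (show ¬((k : ℕ) + 1 = r) by omega)]
          split_ifs <;> first | omega | simp
    · rw [Finset.sum_eq_zero]
      · simp [Matrix.diagonal_apply_ne _ hrs, Matrix.one_apply_ne hrs]
      · intro k _
        have : (r : ℕ) ≠ s := fun h => hrs (Fin.ext h)
        have := k.2
        split_ifs <;> first | omega | simp

lemma IsOscillator.map {𝒜 ℬ : Type*} [Ring 𝒜] [Algebra ℂ 𝒜] [Ring ℬ] [Algebra ℂ ℬ] {q : ℂ}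
    {A B D : 𝒜} (h : IsOscillator q A B D) (φ : 𝒜 →ₐ[ℂ] ℬ) :
    IsOscillator q (φ A) (φ B) (φ D) := by
  constructor
  · simpa using congrArg φ h.ab
  · simpa using congrArg φ h.bd
  · simpa using congrArg φ h.da
  · simpa using congrArg φ h.ad

end Matrices

/-! ### The oscillators on functions of the exponents, and their gradings. -/

lemma mPrime_pos {m : ℕ} (hm : 0 < m) : 0 < mPrime m := by
  rw [mPrime]
  split_ifs with h
  · obtain ⟨k, rfl⟩ := h
    omega
  · exact hm

lemma IsPrimitiveRoot.pow_two_mul_eq_one_iff {q : ℂ} {m : ℕ} (hq : IsPrimitiveRoot q m) (s : ℕ) :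
    q ^ (2 * s) = 1 ↔ mPrime m ∣ s := by
  rw [hq.pow_eq_one_iff_dvd, mPrime]
  split_ifs with h
  · obtain ⟨k, rfl⟩ := h
    rw [← two_mul, Nat.mul_div_cancel_left k two_pos]
    exact Nat.mul_dvd_mul_iff_left two_pos
  · exact (Nat.coprime_two_right.mpr (Nat.not_even_iff_odd.mp h)).dvd_mul_left

/-- The bound on the exponent of `Z_{i,j}` in the monomial basis, where `n = N + 1`; it is `1` for
the generators on or below the antidiagonal. -/
def exponentBound (N m : ℕ) (p : Fin (N + 1) × Fin (N + 1)) : ℕ :=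
  if (p.1 : ℕ) + 1 = N ∧ (p.2 : ℕ) = 0 then m
  else if (p.1 : ℕ) + (p.2 : ℕ) + 1 ≤ N then mPrime m else 1

lemma exponentBound_pos {N m : ℕ} (hm : 0 < m) (p : Fin (N + 1) × Fin (N + 1)) :
    0 < exponentBound N m p := by
  rw [exponentBound]
  split_ifs
  exacts [hm, mPrime_pos hm, one_pos]

/-- The exponents of the monomial basis. -/
abbrev Exponents (N m : ℕ) : Type := ∀ p, Fin (exponentBound N m p)

/-- The generator created by the `k`-th oscillator of level `b`. -/
def position (N b k : ℕ) : Fin (N + 1) × Fin (N + 1) := (Fin.ofNat _ k, Fin.ofNat _ (N - b))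

lemma position_fst {N b k : ℕ} (hk : k < b) (hb : b ≤ N) : ((position N b k).1 : ℕ) = k :=
  Nat.mod_eq_of_lt (by omega)

lemma position_snd (N b k : ℕ) : ((position N b k).2 : ℕ) = N - b :=
  Nat.mod_eq_of_lt (by omega)

lemma position_ne {N b k c r : ℕ} (hk : k < b) (hb : b ≤ N) (hr : r < c) (hc : c ≤ N)
    (h : b ≠ c ∨ k ≠ r) : position N b k ≠ position N c r := by
  intro he
  have h1 := congrArg (fun p => (p.1 : ℕ)) he
  have h2 := congrArg (fun p => (p.2 : ℕ)) he
  simp only [position_fst hk hb, position_fst hr hc, position_snd] at h1 h2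
  omega

lemma exponentBound_position {N m b k : ℕ} (hk : k < b) (hb : b ≤ N) :
    exponentBound N m (position N b k) = if k + 1 = N then m else mPrime m := by
  rw [exponentBound, position_fst hk hb, position_snd]
  by_cases h : k + 1 = N
  · rw [if_pos ⟨h, by omega⟩, if_pos h]
  · rw [if_neg (fun h' => h h'.1), if_pos (by omega), if_neg h]

/-- The creation operators. -/
def creation (N m b k : ℕ) : Module.End ℂ (Exponents N m → ℂ) :=
  liftAt (position N b k) (creationMatrix _ (if k + 1 = N then 1 else 0))

/-- The weight operators. -/
def weight (N m : ℕ) (q : ℂ) (b k : ℕ) : Module.End ℂ (Exponents N m → ℂ) :=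
  liftAt (position N b k) (weightMatrix _ q)

/-- The annihilation operators. -/
def annihilation (N m : ℕ) (q : ℂ) (b k : ℕ) : Module.End ℂ (Exponents N m → ℂ) :=
  liftAt (position N b k) (annihilationMatrix _ q)

section System

variable {N m : ℕ} {q : ℂ}

lemma isOscillatorSystem (hm : 0 < m) (hq : IsPrimitiveRoot q m) :
    IsOscillatorSystem q N (creation N m) (weight N m q) (annihilation N m q) := by
  constructor
  · intro b k hk hb
    refine (isOscillator_matrix (hq.ne_zero hm.ne') ?_ ?_).map _
    · rw [hq.pow_two_mul_eq_one_iff, exponentBound_position hk hb]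
      split_ifs
      · rw [← hq.pow_two_mul_eq_one_iff, mul_comm, pow_mul, hq.pow_eq_one, one_pow]
      · exact dvd_rfl
    · rw [exponentBound_position hk hb]
      split_ifs
      · rw [hq.pow_eq_one, mul_one]
      · rw [zero_mul]
  · intro b k c r hk hb hr hc hne x hx y hy
    have hp := position_ne hk hb hr hc hne
    simp only [Set.mem_insert_iff, Set.mem_singleton_iff] at hx hy
    rcases hx with rfl | rfl | rfl <;> rcases hy with rfl | rfl | rfl <;>
      exact commute_liftAt hp _ _

lemma weight_apply (b k : ℕ) (f : Exponents N m → ℂ) (α : Exponents N m) :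
    weight N m q b k f α = q⁻¹ ^ (α (position N b k) : ℕ) * f α := by
  rw [weight, liftAt_apply, Finset.sum_eq_single (α (position N b k))]
  · simp [weightMatrix]
  · intro r _ hr
    rw [weightMatrix, Matrix.diagonal_apply_ne _ hr.symm, zero_mul]
  · simp

lemma weight_eq_zero (hq : q ≠ 0) {b k : ℕ} {f : Exponents N m → ℂ}
    (h : weight N m q b k f = 0) : f = 0 := by
  funext α
  have := congrFun h α
  rw [weight_apply] at this
  simpa [hq] using this

lemma weight_single (b k : ℕ) (α : Exponents N m) : weight N m q b k (Pi.single α 1) =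
    q⁻¹ ^ (α (position N b k) : ℕ) • (Pi.single α 1 : Exponents N m → ℂ) := by
  funext β
  rw [weight_apply, Pi.smul_apply, smul_eq_mul]
  by_cases h : β = α
  · rw [h]
  · simp [h]

lemma creation_single {b k : ℕ} (α : Exponents N m) (r : Fin (exponentBound N m (position N b k)))
    (hr : (α (position N b k) : ℕ) + 1 = r) : creation N m b k (Pi.single α 1) =
      (Pi.single (Function.update α (position N b k) r) 1 : Exponents N m → ℂ) := by
  rw [creation, liftAt_single, Finset.sum_eq_single r]
  · simp [creationMatrix, hr]
  · intro l _ hl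
    rw [creationMatrix, Matrix.of_apply, if_neg (fun h => hl (Fin.ext (by omega))),
      if_neg (by have := r.2; omega), zero_smul]
  · simp

lemma creation_single_last {b k : ℕ} (α : Exponents N m)
    (r : Fin (exponentBound N m (position N b k))) (hr : (r : ℕ) = 0)
    (hα : (α (position N b k) : ℕ) + 1 = exponentBound N m (position N b k)) :
    creation N m b k (Pi.single α 1) = (if k + 1 = N then 1 else 0 : ℂ) •
      (Pi.single (Function.update α (position N b k) r) 1 : Exponents N m → ℂ) := by
  rw [creation, liftAt_single, Finset.sum_eq_single r]
  · have : ¬ ((α (position N b k) : ℕ) + 1 = r) := by have := r.2; omega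
    rw [creationMatrix, Matrix.of_apply, if_neg this, if_pos ⟨hr, hα⟩]
  · intro l _ hl
    rw [creationMatrix, Matrix.of_apply, if_neg (by have := l.2; omega),
      if_neg (fun h => hl (Fin.ext (by omega))), zero_smul]
  · simp

/-- The annihilation coefficient at exponent `s` is `q (q⁻²ˢ - 1)`, which vanishes exactly when `m'`
divides `s`. -/
lemma dvd_of_annihilation_eq_zero (hm : 0 < m) (hq : IsPrimitiveRoot q m) {b k : ℕ}
    {f : Exponents N m → ℂ} (h : annihilation N m q b k f = 0) (α : Exponents N m)
    (hα : f α ≠ 0) : mPrime m ∣ α (position N b k) := by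
  have hq0 := hq.ne_zero hm.ne'
  rcases Nat.eq_zero_or_pos (α (position N b k) : ℕ) with h0 | h0
  · simp [h0]
  have hlt := (α (position N b k)).2
  set r : Fin (exponentBound N m (position N b k)) := ⟨α (position N b k) - 1, by omega⟩ with hr
  have h1 := congrFun h (Function.update α (position N b k) r)
  rw [annihilation, liftAt_apply, Finset.sum_eq_single (α (position N b k))] at h1
  · rw [Function.update_idem, Function.update_eq_self, Function.update_self, annihilationMatrix,
      Matrix.of_apply, if_pos (by simp [hr]; omega)] at h1
    have h2 := (mul_eq_zero.mp h1).resolve_right hα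
    rw [← hq.pow_two_mul_eq_one_iff]
    rw [inv_pow] at h2
    field_simp at h2
    rw [mul_zero] at h2
    linear_combination -(mul_eq_zero.mp h2).resolve_left hq0
  · intro l _ hl
    rw [Function.update_self, annihilationMatrix, Matrix.of_apply,
      if_neg (fun h => hl (Fin.ext (by simp [hr] at h; omega))), zero_mul]
  · simp

/-- The degree filtration on the exponents. -/
def exponentDegree (N m : ℕ) (α : Exponents N m) : ℤ :=
  ∑ p, ((N : ℤ) - (p.2 : ℕ) - (p.1 : ℕ)) * (((α p : ℕ) % mPrime m : ℕ) : ℤ)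

/-- Oscillator `(c, k)` has degree `c - k > 0`. Exponents count modulo `m'`: a nonzero annihilation
entry starts at an exponent not divisible by `m'`, so the residue drops by exactly one, while
creation, wrap-around included, raises the residue by at most one. -/
lemma qmat_mem_shiftAtMost (hm : 0 < m) (hq : IsPrimitiveRoot q m) {b i j : ℕ} (hb : b ≤ N)
    (hi : i ≤ b) (hj : j ≤ b) :
    qmat (creation N m) (weight N m q) (annihilation N m q) b i j ∈
      shiftAtMost (exponentDegree N m) ((b : ℤ) - i - j) := by
  have hm' := mPrime_pos hm
  have key : ∀ c k, k < c → c ≤ N → ((N : ℤ) - ((position N c k).2 : ℕ) -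
      ((position N c k).1 : ℕ)) = c - k := by
    intro c k hk hc
    rw [position_fst hk hc, position_snd]
    omega
  have := qmat_mem (N := N) (A := creation N m) (B := weight N m q)
    (D := annihilation N m q) (shiftAtMost (exponentDegree N m))
    (fun d f hf α h => by simpa using hf α h) (mul_mem_shiftAtMost _) (fun i => -(i : ℤ))
    ?_ ?_ ?_ hb hi hj
  · convert this using 1
    simp only [Nat.cast_sub hj]
    ring_nf
  · intro c k hk hc
    refine liftAt_mem_shiftAtMost (F := fun p => Fin (exponentBound N m p))
      (fun p r => ((N : ℤ) - (p.2 : ℕ) - (p.1 : ℕ)) * (((r : ℕ) % mPrime m : ℕ) : ℤ)) _ _ _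
      fun r s hrs => ?_
    simp only [key c k hk hc]
    have h1 : (((r : ℕ) % mPrime m : ℕ) : ℤ) ≤ (((s : ℕ) % mPrime m : ℕ) : ℤ) + 1 := by
      simp only [creationMatrix, Matrix.of_apply] at hrs
      norm_cast
      split_ifs at hrs with h h' hkN
      · rw [← h, Nat.add_mod]
        exact (Nat.mod_le _ _).trans (Nat.add_le_add_left (Nat.mod_le _ _) _)
      · simp [h'.1]
      · exact absurd rfl hrs
      · exact absurd rfl hrs
    nlinarith
  · intro c k hk hc
    refine liftAt_mem_shiftAtMost (F := fun p => Fin (exponentBound N m p))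
      (fun p r => ((N : ℤ) - (p.2 : ℕ) - (p.1 : ℕ)) * (((r : ℕ) % mPrime m : ℕ) : ℤ)) _ _ _
      fun r s hrs => ?_
    by_cases h : r = s
    · rw [h, add_zero]
    · exact absurd (Matrix.diagonal_apply_ne _ h) hrs
  · intro c k hk hc
    refine liftAt_mem_shiftAtMost (F := fun p => Fin (exponentBound N m p))
      (fun p r => ((N : ℤ) - (p.2 : ℕ) - (p.1 : ℕ)) * (((r : ℕ) % mPrime m : ℕ) : ℤ)) _ _ _
      fun r s hrs => ?_
    simp only [key c k hk hc]
    have h1 : (((r : ℕ) % mPrime m : ℕ) : ℤ) + 1 = (((s : ℕ) % mPrime m : ℕ) : ℤ) := by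
      simp only [annihilationMatrix, Matrix.of_apply] at hrs
      norm_cast
      split_ifs at hrs with h
      · by_cases hd : mPrime m ∣ s
        · rw [inv_pow, (hq.pow_two_mul_eq_one_iff s).mpr hd] at hrs
          simp at hrs
        · have h3 : (r : ℕ) % mPrime m + 1 < mPrime m := by
            refine lt_of_le_of_ne (Nat.mod_lt _ hm') fun h3 => hd ?_
            rw [← h, Nat.dvd_iff_mod_eq_zero, Nat.add_mod]
            rcases eq_or_ne (mPrime m) 1 with h4 | h4
            · rw [h4, Nat.mod_one]
            · rw [Nat.mod_eq_of_lt (show 1 < mPrime m by omega), h3, Nat.mod_self]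
          rw [← h, Nat.add_mod, Nat.mod_eq_of_lt (show 1 < mPrime m by omega),
            Nat.mod_eq_of_lt h3]
      · exact absurd rfl hrs
    nlinarith

/-- The diagonal operator of a multiplicative character of the weight lattice. -/
def twist (N m : ℕ) (χ : ℕ → ℂˣ) : Module.End ℂ (Exponents N m → ℂ) :=
  diagOp fun α : Exponents N m =>
    ((∏ p, (χ (p.1 : ℕ) / χ (N - (p.2 : ℕ))) ^ (α p : ℕ) : ℂˣ) : ℂ)

lemma twist_mul (χ χ' : ℕ → ℂˣ) : twist N m χ * twist N m χ' = twist N m (χ * χ') := by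
  rw [twist, twist, twist, diagOp_mul]
  congr 1
  funext α
  rw [Pi.mul_apply, ← Units.val_mul, ← Finset.prod_mul_distrib]
  simp only [Pi.mul_apply, mul_div_mul_comm, mul_pow]

/-- Homogeneity of the entries for the torus grading. The wrap-around from exponent `m - 1` to `0`
respects this grading only modulo `m`, which is why the characters must have order dividing `m`. -/
lemma twist_mul_qmat (χ : ℕ → ℂˣ)
    (hχ : ∀ a, χ a ^ m = 1) {b i j : ℕ} (hb : b ≤ N) (hi : i ≤ b) (hj : j ≤ b) :
    twist N m χ * qmat (creation N m) (weight N m q) (annihilation N m q) b i j =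
      ((χ i / χ (b - j) : ℂˣ) : ℂ) •
        (qmat (creation N m) (weight N m q) (annihilation N m q) b i j * twist N m χ) := by
  have key : ∀ c k, k < c → c ≤ N →
      χ ((position N c k).1 : ℕ) / χ (N - ((position N c k).2 : ℕ)) = χ k / χ c := by
    intro c k hk hc
    rw [position_fst hk hc, position_snd, Nat.sub_sub_self hc]
  refine qmat_mem (N := N) (commutingUpTo (twist N m χ))
    (by simp [mem_commutingUpTo]) (mul_mem_commutingUpTo _) (fun i => Additive.ofMul (χ i))
    ?_ ?_ ?_ hb hi hj
  · intro c k hk hc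
    refine liftAt_mem_commutingUpTo (F := fun p => Fin (exponentBound N m p)) _
      (fun p r => (r : ℕ)) _ _ (χ k / χ c) fun r s hrs => ?_
    simp only [key c k hk hc]
    simp only [creationMatrix, Matrix.of_apply] at hrs
    split_ifs at hrs with h h' hkN
    · rw [← h, pow_succ']
    · rw [h'.1, pow_zero, ← pow_succ', h'.2, exponentBound_position hk hc, if_pos hkN, div_pow, hχ,
        hχ, div_one]
    · exact absurd rfl hrs
    · exact absurd rfl hrs
  · intro c k hk hc
    refine liftAt_mem_commutingUpTo (F := fun p => Fin (exponentBound N m p)) _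
      (fun p r => (r : ℕ)) _ _ 1 fun r s hrs => ?_
    by_cases h : r = s
    · rw [h, one_mul]
    · exact absurd (Matrix.diagonal_apply_ne _ h) hrs
  · intro c k hk hc
    refine liftAt_mem_commutingUpTo (F := fun p => Fin (exponentBound N m p)) _
      (fun p r => (r : ℕ)) _ _ (χ c / χ k) fun r s hrs => ?_
    simp only [key c k hk hc]
    simp only [annihilationMatrix, Matrix.of_apply] at hrs
    split_ifs at hrs with h
    · rw [← h, pow_succ', ← mul_assoc, div_mul_div_cancel, div_self', one_mul]
    · exact absurd rfl hrs

lemma twist_single (χ : ℕ → ℂˣ) (α : Exponents N m) : twist N m χ (Pi.single α 1) =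
    ((∏ p, (χ (p.1 : ℕ) / χ (N - (p.2 : ℕ))) ^ (α p : ℕ) : ℂˣ) : ℂ) •
      (Pi.single α 1 : Exponents N m → ℂ) := diagOp_single _ _

end System

/-! ### The cocycle twist from quantum matrices to the relations of `J⁰_q(n)`. -/

lemma qmat_of_lt_col {𝒜 : Type*} [Ring 𝒜] [Algebra ℂ 𝒜] (A B D : ℕ → ℕ → 𝒜) {b j : ℕ} (i : ℕ)
    (h : b < j) : qmat A B D b i j = 0 := by
  induction b generalizing i j with
  | zero => simp [qmat, h.ne']
  | succ b ih =>
    obtain ⟨j, rfl⟩ : ∃ j', j = j' + 1 := ⟨j - 1, by omega⟩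
    have hb : ∀ i, border (qmat A B D b) i (j + 1) = 0 := by
      rintro (_ | i)
      · rfl
      · exact ih i (by omega)
    have key : ∀ s i,
        chain (A (b + 1)) (B (b + 1)) (D (b + 1)) (qmat A B D b) s i (j + 1) = 0 := by
      intro s
      induction s with
      | zero => exact hb
      | succ s ihs =>
        intro i
        simp [chain, rowOp, ihs]
    exact key _ i

/-- The exponents of the twisting cocycle. -/
def cocycle (i a : ℕ) : ℤ := if i < a then (a : ℤ) - i - 1 else 0

/-- The character twisting the entry `(i, j)`. -/
def twistChar (N : ℕ) (u : ℂˣ) (i j a : ℕ) : ℂˣ := u ^ (cocycle i a - cocycle a (N - j))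

/-- The operator by which the generator `(i, j)` acts. -/
def repEntry (N m : ℕ) (u : ℂˣ) (i j : ℕ) : Module.End ℂ (Exponents N m → ℂ) :=
  ((u ^ (-cocycle i (N - j)) : ℂˣ) : ℂ) •
    (qmat (creation N m) (weight N m u) (annihilation N m u) N i j *
      twist N m (twistChar N u i j))

section Relations

variable {N m : ℕ} {u : ℂˣ}

lemma twistChar_mul_comm (i j s t : ℕ) : twistChar N u i t * twistChar N u s j =
    twistChar N u i j * twistChar N u s t := by
  funext a
  simp only [twistChar, Pi.mul_apply, ← zpow_add]
  congr 1
  ring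

variable (hm : 0 < m) (hu : IsPrimitiveRoot (u : ℂ) m)
include hm hu

lemma twistChar_pow (i j a : ℕ) : twistChar N u i j a ^ m = 1 := by
  have : u ^ m = 1 := Units.ext (by simpa using hu.pow_eq_one)
  rw [twistChar, ← zpow_natCast, ← zpow_mul, mul_comm, zpow_mul, zpow_natCast, this, one_zpow]

/-- The first four cocycle terms are the same for every product occurring in a given quadratic
relation; only `cocycle i s + cocycle (N - t) (N - j)` depends on the order and pairing of the
factors. -/
lemma repEntry_mul {i j s t : ℕ} (hs : s ≤ N) (ht : t ≤ N) :
    repEntry N m u i j * repEntry N m u s t =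
      ((u ^ (-cocycle i (N - j) - cocycle s (N - t) - cocycle s (N - j) - cocycle i (N - t) +
          (cocycle i s + cocycle (N - t) (N - j))) : ℂˣ) : ℂ) •
        (qmat (creation N m) (weight N m u) (annihilation N m u) N i j *
          qmat (creation N m) (weight N m u) (annihilation N m u) N s t *
          twist N m (twistChar N u i j * twistChar N u s t)) := by
  rw [repEntry, repEntry, smul_mul_smul_comm, mul_assoc, ← mul_assoc (twist N m _),
    twist_mul_qmat _ (twistChar_pow hm hu i j) le_rfl hs ht, smul_mul_assoc, mul_smul_comm,
    smul_smul, mul_assoc (qmat _ _ _ _ s t), twist_mul, mul_assoc]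
  congr 1
  rw [twistChar, twistChar, div_eq_mul_inv, ← zpow_neg, ← zpow_add, ← Units.val_mul, ← zpow_add, ← Units.val_mul, ← zpow_add]
  congr 2
  ring

/-- For `i ≠ s`, `cocycle i s - cocycle s i` is `s - i` minus its sign, and likewise for columns. So
the twist adds to the exponent `ε` just what turns the sum of the two signs into `s + t - i - j`. -/
lemma repEntry_comm_of_eq {i j s t : ℕ} (hi : i ≤ N) (hj : j ≤ N) (hs : s ≤ N) (ht : t ≤ N)
    (ε : ℤ) (h : qmat (creation N m) (weight N m u) (annihilation N m u) N i j *
          qmat (creation N m) (weight N m u) (annihilation N m u) N s t =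
        ((u ^ ε : ℂˣ) : ℂ) • (qmat (creation N m) (weight N m u) (annihilation N m u) N s t *
          qmat (creation N m) (weight N m u) (annihilation N m u) N i j))
    (hε : ε + cocycle i s + cocycle (N - t) (N - j) =
      (s : ℤ) + t - i - j + cocycle s i + cocycle (N - j) (N - t)) :
    repEntry N m u i j * repEntry N m u s t =
      (u : ℂ) ^ ((s : ℤ) + t - i - j) • (repEntry N m u s t * repEntry N m u i j) := by
  rw [repEntry_mul hm hu hs ht, repEntry_mul hm hu hi hj, h, smul_mul_assoc, smul_smul, smul_smul,
    mul_comm (twistChar N u s t), ← Units.val_zpow_eq_zpow_val, ← Units.val_mul, ← Units.val_mul,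
    ← zpow_add, ← zpow_add]
  congr 3
  linarith

lemma repEntry_comm {i j s t : ℕ} (hi : i ≤ N) (hj : j ≤ N) (hs : s ≤ N) (ht : t ≤ N)
    (h : ((s : ℤ) - i) * ((t : ℤ) - j) ≤ 0) :
    repEntry N m u i j * repEntry N m u s t =
      (u : ℂ) ^ ((s : ℤ) + t - i - j) • (repEntry N m u s t * repEntry N m u i j) := by
  have hQ := (isOscillatorSystem (N := N) hm hu).isQuantumMatrix (hu.ne_zero hm.ne') le_rfl
  have inv : ∀ {x y : Module.End ℂ (Exponents N m → ℂ)}, y * x = (u : ℂ) • (x * y) →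
      x * y = ((u ^ (-1 : ℤ) : ℂˣ) : ℂ) • (y * x) := by
    intro x y hxy
    rw [hxy, smul_smul]
    simp
  rcases lt_trichotomy i s with his | rfl | his <;> rcases lt_trichotomy j t with hjt | rfl | hjt
  · nlinarith
  · refine repEntry_comm_of_eq hm hu hi hj hs ht 1 ?_ ?_
    · simpa using hQ.col j his
    · simp only [cocycle]
      split_ifs <;> omega
  · refine repEntry_comm_of_eq hm hu hi hj hs ht 0 ?_ ?_
    · simpa using hQ.anti his hjt
    · simp only [cocycle]
      split_ifs <;> omega
  · refine repEntry_comm_of_eq hm hu hi hj hs ht 1 ?_ ?_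
    · simpa using hQ.row i hjt
    · simp only [cocycle]
      split_ifs <;> omega
  · refine repEntry_comm_of_eq hm hu hi hj hs ht 0 (by simp) (by omega)
  · refine repEntry_comm_of_eq hm hu hi hj hs ht (-1) ?_ ?_
    · exact inv (hQ.row i hjt)
    · simp only [cocycle]
      split_ifs <;> omega
  · refine repEntry_comm_of_eq hm hu hi hj hs ht 0 ?_ ?_
    · simpa using (hQ.anti his hjt).symm
    · simp only [cocycle]
      split_ifs <;> omega
  · refine repEntry_comm_of_eq hm hu hi hj hs ht (-1) ?_ ?_
    · exact inv (hQ.col j his)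
    · simp only [cocycle]
      split_ifs <;> omega
  · nlinarith

/-- The three products receive the extra exponents `(s - i - 1) + (t - j - 1)`, `0` and `s - i - 1`;
the powers of `u` in the relation bring all of them to `s - i - 1`, leaving the cross relation of
`qmat`. -/
lemma repEntry_cross {i j s t : ℕ} (hs : s ≤ N) (ht : t ≤ N) (his : i < s) (hjt : j < t) :
    (u : ℂ) ^ (1 - (t : ℤ) + j) • (repEntry N m u i j * repEntry N m u s t) =
      (u : ℂ) ^ ((s : ℤ) - i - 1) • (repEntry N m u s t * repEntry N m u i j) +
        ((u : ℂ) - (u : ℂ)⁻¹) • (repEntry N m u i t * repEntry N m u s j) := by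
  have hQ := (isOscillatorSystem (N := N) hm hu).isQuantumMatrix (hu.ne_zero hm.ne') le_rfl
  rw [repEntry_mul hm hu hs ht, repEntry_mul hm hu (by omega) (by omega),
    repEntry_mul hm hu hs (by omega), hQ.cross his hjt, mul_comm (twistChar N u s t),
    twistChar_mul_comm, add_mul, smul_add, smul_add, smul_mul_assoc, smul_smul, smul_smul,
    smul_smul, smul_smul]
  simp only [← Units.val_zpow_eq_zpow_val]
  congr 1
  · rw [← Units.val_mul, ← Units.val_mul, ← zpow_add, ← zpow_add]
    congr 3
    simp only [cocycle]
    split_ifs <;> omega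
  · rw [smul_smul, ← Units.val_mul, ← zpow_add, mul_comm (_ - _)]
    congr 4
    simp only [cocycle]
    split_ifs <;> omega

end Relations

/-! ### The action of the matrix entries on monomials. -/

lemma le_two_mul_mPrime (m : ℕ) : m ≤ 2 * mPrime m := by
  rw [mPrime]
  split_ifs with h
  · obtain ⟨k, rfl⟩ := h
    omega
  · omega

lemma qmat_corner {𝒜 : Type*} [Ring 𝒜] [Algebra ℂ 𝒜] (A B D : ℕ → ℕ → 𝒜) {b : ℕ} (hb : 0 < b) :
    qmat A B D b b 0 = chain (A b) (B b) (D b) (qmat A B D (b - 1)) b b 0 := by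
  cases b with
  | zero => omega
  | succ b => rfl

section Action

variable {N m : ℕ} {q : ℂ}

lemma active_zero_apply (Y : ℕ → ℕ → Module.End ℂ (Exponents N m → ℂ)) (b s : ℕ)
    (f : Exponents N m → ℂ) (α : Exponents N m) :
    chain (creation N m b) (weight N m q b) (annihilation N m q b) Y s s 0 f α =
      (∏ r ∈ Finset.range s, q⁻¹ ^ (α (position N b r) : ℕ)) * f α := by
  induction s with
  | zero => simp [chain, border]
  | succ s ih =>
    rw [chain_succ_self_zero, Module.End.mul_apply, weight_apply, ih, Finset.prod_range_succ]
    ring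

lemma active_zero_single (Y : ℕ → ℕ → Module.End ℂ (Exponents N m → ℂ)) (b s : ℕ)
    (α : Exponents N m) :
    chain (creation N m b) (weight N m q b) (annihilation N m q b) Y s s 0 (Pi.single α 1) =
      (∏ r ∈ Finset.range s, q⁻¹ ^ (α (position N b r) : ℕ)) •
        (Pi.single α 1 : Exponents N m → ℂ) := by
  funext β
  rw [active_zero_apply, Pi.smul_apply, smul_eq_mul]
  by_cases h : β = α
  · rw [h]
  · simp [h]

lemma annihilation_single (b k : ℕ) {α : Exponents N m} (hα : (α (position N b k) : ℕ) = 0) :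
    annihilation N m q b k (Pi.single α 1) = 0 := by
  rw [annihilation, liftAt_single]
  refine Finset.sum_eq_zero fun l _ => ?_
  rw [annihilationMatrix, Matrix.of_apply, if_neg (by omega), zero_smul]

/-- The exponents of the constant monomial. -/
def vacuum (N : ℕ) {m : ℕ} (hm : 0 < m) : Exponents N m := fun p => ⟨0, exponentBound_pos hm p⟩

lemma exists_position_of_ne_zero {α : Exponents N m} {p : Fin (N + 1) × Fin (N + 1)}
    (h : (α p : ℕ) ≠ 0) : ∃ b k, k < b ∧ b ≤ N ∧ p = position N b k := by
  have hlt := (α p).2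
  have hp : (p.1 : ℕ) + (p.2 : ℕ) + 1 ≤ N := by
    by_contra hcon
    have : exponentBound N m p = 1 := by
      rw [exponentBound, if_neg (by omega), if_neg hcon]
    omega
  refine ⟨N - p.2, p.1, by omega, by omega, Prod.ext (Fin.ext ?_) (Fin.ext ?_)⟩
  · rw [position_fst (by omega) (by omega)]
  · rw [position_snd]
    omega

variable (hm : 0 < m)
include hm

/-- On monomials without exponents of level `> b`, the entries of column `N - b` act by
creation. -/
lemma qmat_single (hq : IsPrimitiveRoot q m) {b k : ℕ} (hk : k < b) (hb : b ≤ N)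
    {α : Exponents N m}
    (hα : ∀ c r, b < c → c ≤ N → r < c → (α (position N c r) : ℕ) = 0) :
    qmat (creation N m) (weight N m q) (annihilation N m q) N k (N - b) (Pi.single α 1) =
      (∏ r ∈ Finset.range k, q⁻¹ ^ (α (position N b r) : ℕ)) •
        creation N m b k (Pi.single α 1) := by
  have hsys := isOscillatorSystem (N := N) hm hq
  obtain ⟨U, -, h2, h3⟩ := hsys.exists_factor
    (fun b k _ _ f hf => weight_eq_zero (hq.ne_zero hm.ne') hf) hk.le hb le_rfl
  have h3 := h3 0 (Pi.single α 1) fun c r hc hcN hr => annihilation_single c r (hα c r hc hcN hr)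
  rw [add_zero] at h3
  rw [h3]
  obtain ⟨b, rfl⟩ : ∃ b', b = b' + 1 := ⟨b - 1, by omega⟩
  rw [qmat_succ_zero _ _ _ (by omega), Module.End.mul_apply, active_zero_single, map_smul,
    map_smul, h2]
  intro c hc hcN
  have hcomm := hsys.comm c k (b + 1) k (by omega) hcN hk hb (by omega) (weight N m q c k)
    (by simp) (creation N m (b + 1) k) (by simp)
  rw [← Module.End.mul_apply, hcomm.eq, Module.End.mul_apply, weight_single,
    hα c k hc hcN (by omega), pow_zero, one_smul]

lemma qmat_diagonal_single (hq : IsPrimitiveRoot q m) {k : ℕ} (hk : k ≤ N) :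
    qmat (creation N m) (weight N m q) (annihilation N m q) N k (N - k)
      (Pi.single (vacuum N hm) 1) = (Pi.single (vacuum N hm) 1 : Exponents N m → ℂ) := by
  have hsys := isOscillatorSystem (N := N) hm hq
  obtain ⟨U, -, h2, h3⟩ := hsys.exists_factor
    (fun b k _ _ f hf => weight_eq_zero (hq.ne_zero hm.ne') hf) (le_refl k) hk le_rfl
  have h3 := h3 0 (Pi.single (vacuum N hm) 1) fun c r hc hcN hr => annihilation_single c r rfl
  rw [add_zero] at h3
  have hvac : qmat (creation N m) (weight N m q) (annihilation N m q) k k 0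
      (Pi.single (vacuum N hm) 1) = (Pi.single (vacuum N hm) 1 : Exponents N m → ℂ) := by
    rcases k with _ | k
    · simp [qmat]
    · rw [qmat, active_zero_single]
      simp [vacuum]
  rw [h3, hvac, h2]
  intro c hc hcN
  rw [weight_single]
  simp [vacuum]

/-- Reduced to level `i`, the entry lies in the final active row outside column `0`, which kills the
vacuum. -/
lemma qmat_raising_single (hq : IsPrimitiveRoot q m) {i j : ℕ} (hi : i ≤ N) (hj : j ≤ N)
    (h : N + 1 ≤ i + j) : qmat (creation N m) (weight N m q) (annihilation N m q) N i j
      (Pi.single (vacuum N hm) 1) = 0 := by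
  have hsys := isOscillatorSystem (N := N) hm hq
  obtain ⟨U, -, -, h3⟩ := hsys.exists_factor
    (fun b k _ _ f hf => weight_eq_zero (hq.ne_zero hm.ne') hf) (le_refl i) hi le_rfl
  have h3 := h3 (i + j - (N + 1) + 1) (Pi.single (vacuum N hm) 1)
    fun c r hc hcN hr => annihilation_single c r rfl
  rw [show N - i + (i + j - (N + 1) + 1) = j by omega] at h3
  obtain ⟨b, rfl⟩ : ∃ b, i = b + 1 := ⟨i - 1, by omega⟩
  rw [h3, qmat, hsys.active_apply_eq_zero hi le_rfl (fun k _ => annihilation_single _ k rfl),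
    map_zero]

end Action

/-! ### The vacuum vector satisfies the relations of the restricted Verma module. -/

section Representation

variable {N m : ℕ} {u : ℂˣ} (hm : 0 < m)

lemma repEntry_apply_eq (u : ℂˣ) (i j : ℕ) (f : Exponents N m → ℂ) : repEntry N m u i j f =
    ((u ^ (-cocycle i (N - j)) : ℂˣ) : ℂ) •
      qmat (creation N m) (weight N m u) (annihilation N m u) N i j
        (twist N m (twistChar N u i j) f) := rfl

lemma repEntry_single (u : ℂˣ) (i j : ℕ) (α : Exponents N m) : ∃ c : ℂ, c ≠ 0 ∧
    repEntry N m u i j (Pi.single α 1) =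
      c • qmat (creation N m) (weight N m u) (annihilation N m u) N i j (Pi.single α 1) := by
  refine ⟨_, Units.ne_zero (u ^ (-cocycle i (N - j)) * ∏ p : Fin (N + 1) × Fin (N + 1),
    (twistChar N u i j p.1 / twistChar N u i j (N - p.2)) ^ (α p : ℕ)), ?_⟩
  rw [repEntry_apply_eq, twist_single, map_smul, smul_smul, ← Units.val_mul]

/-- The weight and cyclic relations require the scalar to be exactly `1`; elsewhere
`repEntry_single` suffices. -/
lemma repEntry_single_of_eq_one (u : ℂˣ) {i j : ℕ} {α : Exponents N m}
    (hc : cocycle i (N - j) = 0) (h : ∀ p, (α p : ℕ) ≠ 0 →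
      twistChar N u i j p.1 / twistChar N u i j (N - p.2) = 1) :
    repEntry N m u i j (Pi.single α 1) =
      qmat (creation N m) (weight N m u) (annihilation N m u) N i j (Pi.single α 1) := by
  rw [repEntry_apply_eq, twist_single, Finset.prod_eq_one, hc]
  · simp
  · intro p _
    by_cases hp : (α p : ℕ) = 0
    · rw [hp, pow_zero]
    · rw [h p hp, one_pow]

/-- The monomial exponents supported at the cyclic generator. -/
def cyclicExponent (N : ℕ) {m : ℕ} (hm : 0 < m)
    (r : Fin (exponentBound N m (position N N (N - 1)))) : Exponents N m :=
  Function.update (vacuum N hm) (position N N (N - 1)) r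

lemma cyclicExponent_apply_eq_zero (r : Fin (exponentBound N m (position N N (N - 1))))
    {p : Fin (N + 1) × Fin (N + 1)} (hp : p ≠ position N N (N - 1)) :
    (cyclicExponent N hm r p : ℕ) = 0 := by
  rw [cyclicExponent, Function.update_of_ne hp]
  rfl

lemma cyclicExponent_apply_self (r : Fin (exponentBound N m (position N N (N - 1)))) :
    cyclicExponent N hm r (position N N (N - 1)) = r := Function.update_self _ _ _

lemma cyclicExponent_zero {r : Fin (exponentBound N m (position N N (N - 1)))}
    (hr : (r : ℕ) = 0) : cyclicExponent N hm r = vacuum N hm := by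
  rw [cyclicExponent, Function.update_eq_self_iff]
  exact Fin.ext hr

lemma exponentBound_cyclic (hN : 0 < N) : exponentBound N m (position N N (N - 1)) = m := by
  rw [exponentBound_position (by omega) le_rfl, if_pos (by omega)]

/-- The cyclic generator involves only the adjacent indices `N - 1` and `N`, where the cocycle
vanishes. -/
lemma twistChar_cyclic (hN : 0 < N) (u : ℂˣ) {i : ℕ} (hi : N - 1 ≤ i) (hiN : i ≤ N)
    {r : Fin (exponentBound N m (position N N (N - 1)))} {p : Fin (N + 1) × Fin (N + 1)}
    (hp : (cyclicExponent N hm r p : ℕ) ≠ 0) :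
    twistChar N u i 0 p.1 / twistChar N u i 0 (N - p.2) = 1 := by
  obtain rfl : p = position N N (N - 1) := by
    by_contra h
    exact hp (cyclicExponent_apply_eq_zero hm r h)
  rw [position_fst (by omega) le_rfl, position_snd, twistChar, twistChar]
  have h1 : cocycle i (N - 1) - cocycle (N - 1) (N - 0) = 0 := by
    simp only [cocycle]
    split_ifs <;> omega
  have h2 : cocycle i (N - (N - N)) - cocycle (N - (N - N)) (N - 0) = 0 := by
    simp only [cocycle]
    split_ifs <;> omega
  rw [h1, h2, div_self']

variable (hN : 0 < N) (hu : IsPrimitiveRoot (u : ℂ) m)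
include hN hu

lemma repEntry_cyclicExponent (r r' : Fin (exponentBound N m (position N N (N - 1))))
    (h : (r : ℕ) + 1 = r' ∨ (r : ℕ) + 1 = m ∧ (r' : ℕ) = 0) :
    repEntry N m u (N - 1) 0 (Pi.single (cyclicExponent N hm r) 1) =
      (Pi.single (cyclicExponent N hm r') 1 : Exponents N m → ℂ) := by
  have hpos : ∀ k < N - 1, (cyclicExponent N hm r (position N N k) : ℕ) = 0 := fun k hk =>
    cyclicExponent_apply_eq_zero hm r
      (position_ne (by omega) le_rfl (by omega) le_rfl (Or.inr (by omega)))
  have hq := qmat_single (b := N) (k := N - 1) hm hu (by omega) le_rfl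
    (α := cyclicExponent N hm r) (fun c r hc hc' => by omega)
  rw [Finset.prod_eq_one fun k hk => by rw [hpos k (Finset.mem_range.mp hk), pow_zero],
    one_smul, Nat.sub_self] at hq
  have hupd : Function.update (cyclicExponent N hm r) (position N N (N - 1)) r' =
      cyclicExponent N hm r' := Function.update_idem _ _ _
  rw [repEntry_single_of_eq_one u, hq]
  · rcases h with h | ⟨h1, h2⟩
    · rw [creation_single _ r' (by rw [cyclicExponent_apply_self, h]), hupd]
    · rw [creation_single_last _ r' h2 (by rw [cyclicExponent_apply_self, h1,
        exponentBound_cyclic hN]), hupd, if_pos (by omega), one_smul]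
  · simp only [cocycle]
    split_ifs <;> omega
  · exact fun p hp => twistChar_cyclic hm hN u le_rfl (by omega) hp

lemma repEntry_cyclic_pow :
    (repEntry N m u (N - 1) 0 ^ m) (Pi.single (vacuum N hm) 1) =
      (Pi.single (vacuum N hm) 1 : Exponents N m → ℂ) := by
  have hb := exponentBound_cyclic (m := m) hN
  have key : ∀ k (hk : k < m), (repEntry N m u (N - 1) 0 ^ k) (Pi.single (vacuum N hm) 1) =
      (Pi.single (cyclicExponent N hm ⟨k, by rw [hb]; exact hk⟩) 1 : Exponents N m → ℂ) := by
    intro k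
    induction k with
    | zero => intro hk; rw [cyclicExponent_zero hm rfl, pow_zero, Module.End.one_apply]
    | succ k ih =>
      intro hk
      rw [pow_succ', Module.End.mul_apply, ih (by omega)]
      exact repEntry_cyclicExponent hm hN hu _ _ (Or.inl rfl)
  obtain ⟨k, rfl⟩ : ∃ k, m = k + 1 := ⟨m - 1, by omega⟩
  rw [pow_succ', Module.End.mul_apply, key k (by omega),
    repEntry_cyclicExponent hm hN hu _ ⟨0, by rw [hb]; omega⟩ (Or.inr ⟨rfl, rfl⟩),
    cyclicExponent_zero hm rfl]

omit hN in
-- Away from the cyclic position the creation matrix has wrap-around coefficient `0`, so the `m'`-th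
-- step kills the last monomial. The scalars picked up on the way are irrelevant.
lemma repEntry_nilpotent_pow {i j : ℕ} (h : i + j + 1 ≤ N) (hne : ¬ (i + 1 = N ∧ j = 0)) :
    (repEntry N m u i j ^ mPrime m) (Pi.single (vacuum N hm) 1) = 0 := by
  obtain ⟨b, hb, rfl⟩ : ∃ b ≤ N, j = N - b := ⟨N - j, by omega, by omega⟩
  have hib : i < b := by omega
  have hbound : exponentBound N m (position N b i) = mPrime m := by
    rw [exponentBound_position hib hb, if_neg (fun h => hne ⟨h, by omega⟩)]
  have hstep : ∀ r, ∃ c : ℂ, repEntry N m u i (N - b)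
      (Pi.single (Function.update (vacuum N hm) (position N b i) r) 1) =
        c • creation N m b i (Pi.single (Function.update (vacuum N hm) (position N b i) r) 1) := by
    intro r
    obtain ⟨c, -, hc⟩ := repEntry_single u i (N - b)
      (Function.update (vacuum N hm) (position N b i) r)
    rw [qmat_single hm hu hib hb, smul_smul] at hc
    · exact ⟨_, hc⟩
    · intro c s hc hcN hs
      rw [Function.update_of_ne (position_ne hs hcN hib hb (Or.inl hc.ne'))]
      rfl
  have key : ∀ k (hk : k < mPrime m), ∃ c : ℂ,
      (repEntry N m u i (N - b) ^ k) (Pi.single (vacuum N hm) 1) =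
        c • (Pi.single (Function.update (vacuum N hm) (position N b i)
          ⟨k, by rw [hbound]; exact hk⟩) 1 : Exponents N m → ℂ) := by
    intro k
    induction k with
    | zero =>
      intro hk
      refine ⟨1, ?_⟩
      rw [pow_zero, Module.End.one_apply, one_smul]
      congr 1
      exact (Function.update_eq_self _ _).symm
    | succ k ih =>
      intro hk
      obtain ⟨c, hc⟩ := ih (by omega)
      obtain ⟨c', hc'⟩ := hstep ⟨k, by rw [hbound]; omega⟩
      rw [pow_succ', Module.End.mul_apply, hc, map_smul, hc',
        creation_single _ ⟨k + 1, by rw [hbound]; exact hk⟩ (by rw [Function.update_self]),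
        Function.update_idem, smul_smul]
      exact ⟨_, rfl⟩
  have hpos := mPrime_pos hm
  obtain ⟨k, hk⟩ : ∃ k, mPrime m = k + 1 := ⟨mPrime m - 1, by omega⟩
  obtain ⟨c, hc⟩ := key k (by omega)
  obtain ⟨c', hc'⟩ := hstep ⟨k, by rw [hbound]; omega⟩
  rw [hk, pow_succ', Module.End.mul_apply, hc, map_smul, hc',
    creation_single_last _ ⟨0, by rw [hbound]; omega⟩ rfl
      (by rw [Function.update_self]; simp only [hbound, hk]), if_neg (fun h => hne ⟨h, by omega⟩), zero_smul,
    smul_zero, smul_zero]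

omit hN in
lemma repEntry_raising {i j : ℕ} (hi : i ≤ N) (hj : j ≤ N) (h : N + 1 ≤ i + j) :
    repEntry N m u i j (Pi.single (vacuum N hm) 1) = 0 := by
  obtain ⟨c, -, hc⟩ := repEntry_single u i j (vacuum N hm)
  rw [hc, qmat_raising_single hm hu hi hj h, smul_zero]

omit hN in
lemma repEntry_diagonal {k : ℕ} (hk : k ≤ N) :
    repEntry N m u k (N - k) (Pi.single (vacuum N hm) 1) =
      (Pi.single (vacuum N hm) 1 : Exponents N m → ℂ) := by
  rw [repEntry_single_of_eq_one u, qmat_diagonal_single hm hu hk]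
  · rw [Nat.sub_sub_self hk]
    simp [cocycle]
  · intro p hp
    exact absurd rfl hp

/-! ### Irreducibility -/

variable {W : Submodule ℂ (Exponents N m → ℂ)}
  (hW : ∀ i ≤ N, ∀ j ≤ N, ∀ f ∈ W, repEntry N m u i j f ∈ W)
include hm hW

lemma eq_top_of_vacuum_mem (h : Pi.single (vacuum N hm) 1 ∈ W) : W = ⊤ := by
  have key : ∀ d, ∀ α : Exponents N m, ∑ p, (α p : ℕ) = d → Pi.single α 1 ∈ W := by
    intro d
    induction d using Nat.strong_induction_on with
    | _ d ih =>
    intro α hα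
    by_cases h0 : ∀ p, (α p : ℕ) = 0
    · obtain rfl : α = vacuum N hm := funext fun p => Fin.ext (h0 p)
      exact h
    push Not at h0
    -- The least column with a nonzero exponent is the highest level in use, so `qmat_single`
    -- applies there; the monomial is then created from one with that exponent lowered by one.
    obtain ⟨p, hp, hmin⟩ := Finset.exists_min_image
      (Finset.univ.filter fun p => (α p : ℕ) ≠ 0) (fun p => (p.2 : ℕ))
      (h0.imp fun p hp => by simpa using hp)
    simp only [Finset.mem_filter, Finset.mem_univ, true_and] at hp hmin
    obtain ⟨b, k, hk, hb, rfl⟩ := exists_position_of_ne_zero hp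
    have hlt := (α (position N b k)).2
    set r : Fin (exponentBound N m (position N b k)) := ⟨α (position N b k) - 1, by omega⟩ with hr
    set β := Function.update α (position N b k) r with hβ
    have hβW : Pi.single β 1 ∈ W := by
      refine ih _ ?_ β rfl
      have := sum_update (F := fun p => Fin (exponentBound N m p)) (fun p s => ((s : ℕ) : ℤ)) α
        (position N b k) r
      rw [← hβ] at this
      zify
      rw [this, ← hα]
      push_cast
      simp only [hr]
      omega
    obtain ⟨c, hc0, hc⟩ := repEntry_single u k (N - b) β
    rw [qmat_single hm hu hk hb, creation_single β (α (position N b k))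
      (by rw [hβ, Function.update_self]; simp only [hr]; omega), hβ, Function.update_idem,
      Function.update_eq_self, smul_smul] at hc
    · have hmem := hW k (by omega) (N - b) (by omega) _ hβW
      rw [hβ, hc] at hmem
      refine (W.smul_mem_iff (mul_ne_zero hc0 ?_)).mp hmem
      refine Finset.prod_ne_zero_iff.mpr fun r _ => pow_ne_zero _ (inv_ne_zero u.ne_zero)
    · intro c s hc hcN hs
      rw [hβ, Function.update_of_ne (position_ne hs hcN hk hb (Or.inl hc.ne'))]
      by_contra hcon
      have := hmin _ hcon
      rw [position_snd, position_snd] at this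
      omega
  rw [eq_top_iff]
  intro f _
  rw [pi_eq_sum_univ' f]
  refine W.sum_mem fun α _ => W.smul_mem _ ?_
  convert key _ α rfl using 1

/-- A vector of `W` of least degree is killed by every entry strictly past the antidiagonal, since
these lower the degree and preserve `W`. Descending from level `N`, the annihilation already known
at higher levels reduces row `b` to the last row of `qmat b`. -/
lemma exists_annihilated (hne : W ≠ ⊥) : ∃ f ∈ W, f ≠ 0 ∧
    ∀ b k, k < b → b ≤ N → annihilation N m u b k f = 0 := by
  have hsys := isOscillatorSystem (N := N) hm hu
  have hinj : ∀ b k, k < b → b ≤ N → ∀ f : Exponents N m → ℂ, weight N m u b k f = 0 → f = 0 :=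
    fun b k _ _ f hf => weight_eq_zero u.ne_zero hf
  obtain ⟨l, hl⟩ := (Set.finite_range (exponentDegree N m)).bddBelow
  obtain ⟨l', hl'⟩ := (Set.finite_range (exponentDegree N m)).bddAbove
  obtain ⟨f₀, hf₀, hf₀'⟩ := W.ne_bot_iff.mp hne
  obtain ⟨d, ⟨f, hfW, hf0, hfd⟩, hmin⟩ := Int.exists_least_of_bdd
    (P := fun d => ∃ f ∈ W, f ≠ 0 ∧ ∀ α, f α ≠ 0 → exponentDegree N m α ≤ d)
    ⟨l, fun d ⟨f, _, hf, hd⟩ => by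
      obtain ⟨α, hα⟩ := Function.ne_iff.mp hf
      exact (hl ⟨α, rfl⟩).trans (hd α hα)⟩
    ⟨l', f₀, hf₀, hf₀', fun α _ => hl' ⟨α, rfl⟩⟩
  refine ⟨f, hfW, hf0, ?_⟩
  have key : ∀ e b, N - b = e → ∀ k, k < b → b ≤ N → annihilation N m u b k f = 0 := by
    intro e
    induction e using Nat.strong_induction_on with
    | _ e ih =>
    intro b he k hk hb
    have hann : ∀ c r, b < c → c ≤ N → r < c → annihilation N m u c r f = 0 :=
      fun c r hc hcN hr => ih (N - c) (by omega) c rfl r hr hcN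
    obtain ⟨U, hU, -, hU'⟩ := hsys.exists_factor hinj (le_refl b) hb le_rfl
    have hrow : ∀ j, qmat (creation N m) (weight N m u) (annihilation N m u) b b (j + 1) f = 0 := by
      intro j
      rcases Nat.lt_or_ge b (j + 1) with hj | hj
      · rw [qmat_of_lt_col _ _ _ _ hj, LinearMap.zero_apply]
      have hzero : repEntry N m u b (N - b + (j + 1)) f = 0 := by
        by_contra hcon
        have hT := diagOp_mem_shiftAtMost (exponentDegree N m)
          (fun α : Exponents N m => ((∏ p, (twistChar N u b (N - b + (j + 1)) (p.1 : ℕ) /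
            twistChar N u b (N - b + (j + 1)) (N - (p.2 : ℕ))) ^ (α p : ℕ) : ℂˣ) : ℂ)) d f hfd
        have hZ := qmat_mem_shiftAtMost hm hu le_rfl hb
          (show N - b + (j + 1) ≤ N by omega) _ _ hT
        have := hmin (d - (j + 1)) ⟨_, hW b hb _ (by omega) f hfW, hcon, fun α hα => ?_⟩
        · omega
        · have h1 := hZ α (fun h0 => hα ?_)
          · push_cast [Nat.cast_sub hb] at h1
            linarith
          · rw [repEntry_apply_eq, Pi.smul_apply, smul_eq_mul]
            exact mul_eq_zero_of_right _ h0
      have hz : qmat (creation N m) (weight N m u) (annihilation N m u) N b (N - b + (j + 1)) f =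
          0 := by
        rw [repEntry_apply_eq] at hzero
        have h1 := (smul_eq_zero.mp hzero).resolve_left (Units.ne_zero _)
        have h2 := DFunLike.congr_fun (twist_mul_qmat (q := u)
          (twistChar N u b (N - b + (j + 1))) (twistChar_pow hm hu _ _) le_rfl hb
          (show N - b + (j + 1) ≤ N by omega)) f
        rw [LinearMap.smul_apply, Module.End.mul_apply, Module.End.mul_apply, h1, smul_zero] at h2
        -- The twist is diagonal with nonzero eigenvalues, so it can be cancelled.
        funext α
        exact (mul_eq_zero.mp (congrFun h2 α)).resolve_left (Units.ne_zero _)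
      exact hU _ (by rw [← hU' _ _ hann, hz])
    obtain ⟨b, rfl⟩ : ∃ b', b = b' + 1 := ⟨b - 1, by omega⟩
    exact hsys.annihilation_eq_zero u.ne_zero hinj hb hrow hk
  exact fun b k hk hb => key _ b rfl k hk hb

/-- Only the cyclic position admits a nonzero exponent divisible by `m'`, and since `m ≤ 2 m'` that
exponent is `m'`. So the annihilated vector combines at most the vacuum and one power of the cyclic
generator. -/
lemma vacuum_mem (hne : W ≠ ⊥) : Pi.single (vacuum N hm) 1 ∈ W := by
  have hb := exponentBound_cyclic (m := m) hN
  obtain ⟨f, hfW, hf0, hann⟩ := exists_annihilated hm hN hu hW hne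
  have hsupp : ∀ α, f α ≠ 0 → ∃ r, α = cyclicExponent N hm r ∧ mPrime m ∣ r := by
    intro α hα
    refine ⟨α (position N N (N - 1)), funext fun p => ?_,
      dvd_of_annihilation_eq_zero hm hu (hann N (N - 1) (by omega) le_rfl) α hα⟩
    by_cases hp : p = position N N (N - 1)
    · rw [hp, cyclicExponent_apply_self]
    refine Fin.ext ?_
    rw [cyclicExponent_apply_eq_zero hm _ hp]
    by_contra hcon
    obtain ⟨b, k, hk, hbN, rfl⟩ := exists_position_of_ne_zero hcon
    have hdvd := dvd_of_annihilation_eq_zero hm hu (hann b k hk hbN) α hα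
    have hlt := (α (position N b k)).2.trans_eq (exponentBound_position hk hbN)
    rw [if_neg] at hlt
    · exact hcon (Nat.eq_zero_of_dvd_of_lt hdvd hlt)
    · rintro h
      apply hp
      rw [show b = N by omega, show k = N - 1 by omega]
  -- Repeated action of the cyclic generator raises the exponent until it wraps around to `0`.
  have hdown : ∀ e (r : Fin (exponentBound N m (position N N (N - 1)))), m - r = e →
      Pi.single (cyclicExponent N hm r) 1 ∈ W → Pi.single (vacuum N hm) 1 ∈ W := by
    intro e
    induction e with
    | zero => intro r hr; have := r.2; omega
    | succ e ih =>
      intro r hr hmem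
      have hlt := r.2
      have hmem' := hW (N - 1) (by omega) 0 (by omega) _ hmem
      by_cases hlast : (r : ℕ) + 1 = m
      · rwa [repEntry_cyclicExponent hm hN hu r ⟨0, by omega⟩ (Or.inr ⟨hlast, rfl⟩),
          cyclicExponent_zero hm rfl] at hmem'
      · rw [repEntry_cyclicExponent hm hN hu r ⟨r + 1, by omega⟩ (Or.inl rfl)] at hmem'
        exact ih _ (by simp; omega) hmem'
  have hq0 := u.ne_zero
  have hcorner : ∀ β, (repEntry N m u N 0 f) β =
      (∏ k ∈ Finset.range N, (u : ℂ)⁻¹ ^ (β (position N N k) : ℕ)) *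
        ((∏ p, (twistChar N u N 0 p.1 / twistChar N u N 0 (N - p.2)) ^ (β p : ℕ) : ℂˣ) *
          f β) := by
    intro β
    rw [repEntry_apply_eq, qmat_corner _ _ _ hN, Pi.smul_apply, active_zero_apply]
    have h0 : cocycle N (N - 0) = 0 := by simp [cocycle]
    rw [h0, neg_zero, zpow_zero, Units.val_one, one_smul]
    rfl
  have hcyclic : ∀ r, (repEntry N m u N 0 f) (cyclicExponent N hm r) =
      (u : ℂ)⁻¹ ^ (r : ℕ) * f (cyclicExponent N hm r) := by
    intro r
    rw [hcorner, Finset.prod_eq_single (N - 1), cyclicExponent_apply_self, Finset.prod_eq_one,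
      Units.val_one, one_mul]
    · intro p _
      by_cases hp : (cyclicExponent N hm r p : ℕ) = 0
      · rw [hp, pow_zero]
      · rw [twistChar_cyclic hm hN u (by omega) le_rfl hp, one_pow]
    · intro k hk hk'
      rw [Finset.mem_range] at hk
      rw [cyclicExponent_apply_eq_zero hm r
        (position_ne hk le_rfl (by omega) le_rfl (Or.inr hk')), pow_zero]
    · intro h
      exact absurd (Finset.mem_range.mpr (by omega)) h
  -- Without a vacuum component, `f` is a multiple of a single monomial and the cyclic generator
  -- carries it to the vacuum.
  by_cases hvac : f (vacuum N hm) = 0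
  · obtain ⟨α, hα⟩ := Function.ne_iff.mp hf0
    obtain ⟨r, rfl, hr⟩ := hsupp α hα
    have huniq : ∀ s : Fin (exponentBound N m (position N N (N - 1))),
        f (cyclicExponent N hm s) ≠ 0 → mPrime m ∣ s → (s : ℕ) = mPrime m := by
      rintro s hs ⟨c, hc⟩
      have hlt := s.2
      have h2 := le_two_mul_mPrime m
      have hc0 : c ≠ 0 := by
        rintro rfl
        rw [cyclicExponent_zero hm (by simpa using hc)] at hs
        exact hs hvac
      have hc1 : c < 2 := by
        by_contra hcon
        have : mPrime m * 2 ≤ mPrime m * c := Nat.mul_le_mul_left _ (by omega)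
        omega
      rw [hc, show c = 1 by omega, mul_one]
    have hf : f = f (cyclicExponent N hm r) • Pi.single (cyclicExponent N hm r) 1 := by
      funext β
      by_cases hβ : β = cyclicExponent N hm r
      · rw [hβ]
        simp
      rw [Pi.smul_apply, Pi.single_eq_of_ne hβ, smul_zero]
      by_contra hcon
      obtain ⟨s, rfl, hs⟩ := hsupp β hcon
      apply hβ
      congr 1
      exact Fin.ext ((huniq s hcon hs).trans (huniq r hα hr).symm)
    refine hdown _ r rfl ?_
    rw [hf] at hfW
    exact (W.smul_mem_iff hα).mp hfW
  -- The corner entry has eigenvalue `1` on the vacuum and `q ^ (-m') = -1` on the other possible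
  -- monomial, so adding `f` to its image leaves twice the vacuum component.
  · have hg := W.add_mem (hW N le_rfl 0 (Nat.zero_le _) f hfW) hfW
    have hgf : repEntry N m u N 0 f + f =
        (2 * f (vacuum N hm)) • Pi.single (vacuum N hm) 1 := by
      funext β
      rw [Pi.add_apply, Pi.smul_apply]
      by_cases hβ : f β = 0
      · rw [hcorner, hβ, mul_zero, mul_zero, Pi.single_eq_of_ne, smul_zero, add_zero]
        rintro rfl
        exact hvac hβ
      obtain ⟨r, rfl, hr⟩ := hsupp β hβ
      rw [hcyclic]
      by_cases hr0 : (r : ℕ) = 0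
      · rw [cyclicExponent_zero hm hr0, hr0]
        simp
        ring
      · have hlt := r.2
        have h1 : (u : ℂ) ^ (r : ℕ) ≠ 1 := hu.pow_ne_one_of_pos_of_lt hr0 (by omega)
        have h2 : ((u : ℂ) ^ (r : ℕ)) ^ 2 = 1 := by
          rw [← pow_mul, mul_comm, hu.pow_two_mul_eq_one_iff]
          exact hr
        have h3 : (u : ℂ) ^ (r : ℕ) = -1 := (sq_eq_one_iff.mp h2).resolve_left h1
        rw [inv_pow, h3, Pi.single_eq_of_ne, smul_zero]
        · norm_num
        · intro h
          apply hr0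
          rw [← cyclicExponent_apply_self hm r, h]
          rfl
    rw [hgf] at hg
    exact (W.smul_mem_iff (mul_ne_zero two_ne_zero hvac)).mp hg

/-- The operators `repEntry` act irreducibly. -/
lemma eq_top_of_ne_bot (hne : W ≠ ⊥) : W = ⊤ :=
  eq_top_of_vacuum_mem hm hN hu hW (vacuum_mem hm hN hu hW hne)

end Representation

/-! ### Reordering words in the generators. -/

section Words

variable {n : ℕ} {q : ℂ}

lemma JZero.gen_comm {i j s t : Fin n}
    (h : ((s : ℤ) - (i : ℤ)) * ((t : ℤ) - (j : ℤ)) ≤ 0) :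
    JZero.gen n q i j * JZero.gen n q s t = q ^ ((s : ℤ) + (t : ℤ) - (i : ℤ) - (j : ℤ)) •
      (JZero.gen n q s t * JZero.gen n q i j) := by
  have := RingQuot.mkAlgHom_rel ℂ (JZeroRel.comm (q := q) i j s t h)
  simp only [map_mul, map_smul] at this
  exact this

lemma JZero.gen_cross {i j s t : Fin n} (his : i < s) (hjt : j < t) :
    q ^ (1 - (t : ℤ) + (j : ℤ)) • (JZero.gen n q i j * JZero.gen n q s t) =
      q ^ ((s : ℤ) - (i : ℤ) - 1) • (JZero.gen n q s t * JZero.gen n q i j) +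
        (q - q⁻¹) • (JZero.gen n q i t * JZero.gen n q s j) := by
  have := RingQuot.mkAlgHom_rel ℂ (JZeroRel.cross (q := q) i j s t his hjt)
  simp only [map_mul, map_smul, map_add] at this
  exact this

/-- The product of the generators in a word. -/
def wordProd (q : ℂ) (L : List (Fin n × Fin n)) : JZero n q :=
  (L.map fun p => JZero.gen n q p.1 p.2).prod

/-- The weight of a word, which drops when the relations are applied. -/
def wordWeight (L : List (Fin n × Fin n)) : ℕ :=
  (L.map fun p => ((p.1 : ℕ) + 1) * ((p.2 : ℕ) + 1)).sum

/-- The span of the words of weight below `k`. -/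
def lighterWords (n : ℕ) (q : ℂ) (k : ℕ) : Submodule ℂ (JZero n q) :=
  Submodule.span ℂ (wordProd q '' {L : List (Fin n × Fin n) | wordWeight L < k})

lemma wordProd_append (L L' : List (Fin n × Fin n)) :
    wordProd q (L ++ L') = wordProd q L * wordProd q L' := by simp [wordProd]

lemma wordWeight_append (L L' : List (Fin n × Fin n)) :
    wordWeight (L ++ L') = wordWeight L + wordWeight L' := by simp [wordWeight]

lemma wordProd_mem_lighterWords {L : List (Fin n × Fin n)} {k : ℕ} (h : wordWeight L < k) :
    wordProd q L ∈ lighterWords n q k := Submodule.subset_span ⟨L, h, rfl⟩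

lemma wordProd_mul_mem (L : List (Fin n × Fin n)) {k : ℕ} {x : JZero n q}
    (hx : x ∈ lighterWords n q k) :
    wordProd q L * x ∈ lighterWords n q (wordWeight L + k) := by
  induction hx using Submodule.span_induction with
  | mem x hx =>
    obtain ⟨L', hL', rfl⟩ := hx
    rw [← wordProd_append]
    apply wordProd_mem_lighterWords
    rw [wordWeight_append]
    exact Nat.add_lt_add_left hL' _
  | zero => simp
  | add x y _ _ hx hy =>
    rw [mul_add]
    exact add_mem hx hy
  | smul c x _ hx =>
    rw [mul_smul_comm]
    exact Submodule.smul_mem _ _ hx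

lemma mul_wordProd_mem (L : List (Fin n × Fin n)) {k : ℕ} {x : JZero n q}
    (hx : x ∈ lighterWords n q k) :
    x * wordProd q L ∈ lighterWords n q (k + wordWeight L) := by
  induction hx using Submodule.span_induction with
  | mem x hx =>
    obtain ⟨L', hL', rfl⟩ := hx
    rw [← wordProd_append]
    apply wordProd_mem_lighterWords
    rw [wordWeight_append]
    exact Nat.add_lt_add_right hL' _
  | zero => simp
  | add x y _ _ hx hy =>
    rw [add_mul]
    exact add_mem hx hy
  | smul c x _ hx =>
    rw [smul_mul_assoc]
    exact Submodule.smul_mem _ _ hx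

/-- The correction term of the cross relation pairs the smaller row with the larger column, so by
the rearrangement inequality its weight `∑ (i + 1) (j + 1)` is strictly smaller. -/
lemma exists_wordProd_swap (hq : q ≠ 0) (a b : Fin n × Fin n) : ∃ c : ℂ,
    wordProd q [a, b] - c • wordProd q [b, a] ∈ lighterWords n q (wordWeight [a, b]) := by
  have key : ∀ a b : Fin n × Fin n, a.1 < b.1 → a.2 < b.2 →
      wordProd q [(a.1, b.2), (b.1, a.2)] ∈ lighterWords n q (wordWeight [a, b]) := by
    intro a b h1 h2
    apply wordProd_mem_lighterWords
    simp only [wordWeight, List.map_cons, List.map_nil, List.sum_cons, List.sum_nil, add_zero]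
    have h1 : (a.1 : ℕ) < b.1 := h1
    have h2 : (a.2 : ℕ) < b.2 := h2
    nlinarith [Nat.mul_lt_mul_of_lt_of_le h1 h2.le]
  obtain ⟨i, j⟩ := a
  obtain ⟨s, t⟩ := b
  by_cases h : ((s : ℤ) - (i : ℤ)) * ((t : ℤ) - (j : ℤ)) ≤ 0
  · refine ⟨q ^ ((s : ℤ) + (t : ℤ) - (i : ℤ) - (j : ℤ)), ?_⟩
    simp [wordProd, JZero.gen_comm h]
  rcases pos_and_pos_or_neg_and_neg_of_mul_pos (not_le.mp h) with ⟨h1, h2⟩ | ⟨h1, h2⟩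
  · have h1 : i < s := by rw [Fin.lt_def]; omega
    have h2 : j < t := by rw [Fin.lt_def]; omega
    have hx := JZero.gen_cross (q := q) h1 h2
    have hk := key (i, j) (s, t) h1 h2
    simp only [wordProd, List.map_cons, List.map_nil, List.prod_cons, List.prod_nil,
      mul_one] at hk ⊢
    have h0 : q ^ (1 - (t : ℤ) + (j : ℤ)) ≠ 0 := zpow_ne_zero _ hq
    refine ⟨(q ^ (1 - (t : ℤ) + (j : ℤ)))⁻¹ * q ^ ((s : ℤ) - (i : ℤ) - 1), ?_⟩
    rw [← inv_smul_smul₀ h0 (JZero.gen n q i j * _), hx, smul_add, smul_smul, smul_smul,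
      add_sub_cancel_left]
    exact Submodule.smul_mem _ _ hk
  · have h1 : s < i := by rw [Fin.lt_def]; omega
    have h2 : t < j := by rw [Fin.lt_def]; omega
    have hx := JZero.gen_cross (q := q) h1 h2
    have hk := key (s, t) (i, j) h1 h2
    rw [show wordWeight [(s, t), (i, j)] = wordWeight [(i, j), (s, t)] by
      simp [wordWeight, add_comm]] at hk
    simp only [wordProd, List.map_cons, List.map_nil, List.prod_cons, List.prod_nil,
      mul_one] at hk ⊢
    have h0 : q ^ ((i : ℤ) - (s : ℤ) - 1) ≠ 0 := zpow_ne_zero _ hq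
    refine ⟨(q ^ ((i : ℤ) - (s : ℤ) - 1))⁻¹ * q ^ (1 - (j : ℤ) + (t : ℤ)), ?_⟩
    rw [mul_smul, hx, smul_add, inv_smul_smul₀ h0, sub_add_cancel_left]
    exact neg_mem (Submodule.smul_mem _ _ (Submodule.smul_mem _ _ hk))

lemma _root_.List.Perm.wordWeight_eq {L L' : List (Fin n × Fin n)} (h : L.Perm L') :
    wordWeight L = wordWeight L' := (h.map _).sum_eq

/-- A permutation of the letters changes the product by a scalar, up to lighter words. -/
lemma exists_wordProd_perm (hq : q ≠ 0) {L L' : List (Fin n × Fin n)} (h : L.Perm L') : ∃ c : ℂ,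
    wordProd q L - c • wordProd q L' ∈ lighterWords n q (wordWeight L) := by
  induction h with
  | nil => exact ⟨1, by simp⟩
  | @cons a L L' h ih =>
    obtain ⟨c, hc⟩ := ih
    refine ⟨c, ?_⟩
    have := wordProd_mul_mem [a] hc
    rwa [mul_sub, mul_smul_comm, ← wordProd_append, ← wordProd_append, ← wordWeight_append]
      at this
  | swap a b L =>
    obtain ⟨c, hc⟩ := exists_wordProd_swap hq b a
    refine ⟨c, ?_⟩
    have := mul_wordProd_mem L hc
    rwa [sub_mul, smul_mul_assoc, ← wordProd_append, ← wordProd_append, ← wordWeight_append]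
      at this
  | @trans L L' L'' h h' ih ih' =>
    obtain ⟨c, hc⟩ := ih
    obtain ⟨c', hc'⟩ := ih'
    refine ⟨c * c', ?_⟩
    rw [← h.wordWeight_eq] at hc'
    have := add_mem hc (Submodule.smul_mem _ c hc')
    rwa [smul_sub, smul_smul, sub_add_sub_cancel] at this

lemma span_wordProd (n : ℕ) (q : ℂ) :
    Submodule.span ℂ (Set.range (wordProd (n := n) q)) = ⊤ := by
  rw [eq_top_iff]
  rintro x -
  obtain ⟨x, rfl⟩ := RingQuot.mkAlgHom_surjective ℂ (JZeroRel n q) x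
  induction x using FreeAlgebra.induction with
  | grade0 r =>
    rw [AlgHom.commutes, Algebra.algebraMap_eq_smul_one]
    exact Submodule.smul_mem _ _ (Submodule.subset_span ⟨[], by simp [wordProd]⟩)
  | grade1 p => exact Submodule.subset_span ⟨[p], by simp [wordProd, JZero.gen]⟩
  | mul a b ha hb =>
    rw [map_mul]
    have := Submodule.mul_mem_mul ha hb
    rw [Submodule.span_mul_span] at this
    refine Submodule.span_mono ?_ this
    rintro _ ⟨_, ⟨L, rfl⟩, _, ⟨L', rfl⟩, rfl⟩
    exact ⟨L ++ L', wordProd_append L L'⟩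
  | add a b ha hb =>
    rw [map_add]
    exact add_mem ha hb

end Words

/-! ### The ordered monomials with bounded exponents span the module. -/

section UpperBound

variable {N m : ℕ} {q : ℂ}

/-- The word with the given exponents, in some fixed order. -/
def exponentWord (α : Exponents N m) : List (Fin (N + 1) × Fin (N + 1)) :=
  (∑ p, (α p : ℕ) • ({p} : Multiset (Fin (N + 1) × Fin (N + 1)))).toList

lemma count_exponentWord (α : Exponents N m) (p : Fin (N + 1) × Fin (N + 1)) :
    (exponentWord α : Multiset (Fin (N + 1) × Fin (N + 1))).count p = α p := by
  rw [exponentWord, Multiset.coe_toList, Multiset.count_sum']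
  simp [Multiset.count_singleton]

variable (N m q) in
/-- The class of an element of the algebra in the restricted Verma module. -/
def verma : JZero (N + 1) q →ₗ[ℂ] RestrictedVerma (N + 1) q m (fun _ => 1) 1 :=
  (restrictedVermaIdeal (N + 1) q m (fun _ => 1) 1).mkQ.restrictScalars ℂ

lemma exists_gen_pow_sub_mem (p : Fin (N + 1) × Fin (N + 1)) : ∃ c : ℂ,
    JZero.gen (N + 1) q p.1 p.2 ^ exponentBound N m p - algebraMap ℂ _ c ∈
      restrictedVermaIdeal (N + 1) q m (fun _ => 1) 1 := by
  have h1 := p.1.2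
  have h2 := p.2.2
  rw [exponentBound]
  split_ifs with h h'
  · exact ⟨1, Submodule.subset_span (.cyclic _ _ (by omega) (by omega))⟩
  · refine ⟨0, ?_⟩
    rw [map_zero, sub_zero]
    exact Submodule.subset_span (.nilpotent _ _ (by omega) (by omega))
  · rw [pow_one]
    by_cases h3 : (p.1 : ℕ) + p.2 = N
    · exact ⟨1, Submodule.subset_span (.weight _ _ (by omega))⟩
    · refine ⟨0, ?_⟩
      rw [map_zero, sub_zero]
      exact Submodule.subset_span (.raising _ _ (by omega))

/-- Induction on the weight: reordering costs only lighter words, and a letter occurring too often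
can be removed. Every letter has positive weight, so the removal is also a descent. -/
lemma verma_wordProd_mem (hm : 0 < m) (hq : q ≠ 0) : ∀ (k : ℕ)
    (L : List (Fin (N + 1) × Fin (N + 1))), wordWeight L = k →
    verma N m q (wordProd q L) ∈
      Submodule.span ℂ (Set.range fun α : Exponents N m => verma N m q (wordProd q (exponentWord α))) := by
  intro k
  induction k using Nat.strong_induction_on with
  | _ k ih =>
  intro L hL
  set P := Submodule.span ℂ
    (Set.range fun α : Exponents N m => verma N m q (wordProd q (exponentWord α))) with hP
  have hlight : ∀ x ∈ lighterWords (N + 1) q k, verma N m q x ∈ P := by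
    intro x hx
    have hle : lighterWords (N + 1) q k ≤ P.comap (verma N m q) := by
      rw [lighterWords, Submodule.span_le]
      rintro _ ⟨L', hL', rfl⟩
      exact ih _ hL' L' rfl
    exact hle hx
  have hperm : ∀ L', L.Perm L' → verma N m q (wordProd q L') ∈ P →
      verma N m q (wordProd q L) ∈ P := by
    intro L' hLL' hmem
    obtain ⟨c, hc⟩ := exists_wordProd_perm hq hLL'
    rw [hL] at hc
    have := add_mem (hlight _ hc) (P.smul_mem c hmem)
    rwa [← map_smul, ← map_add, sub_add_cancel] at this
  by_cases hcount : ∀ p, (L : Multiset (Fin (N + 1) × Fin (N + 1))).count p < exponentBound N m p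
  · refine hperm (exponentWord fun p => ⟨_, hcount p⟩) ?_ (Submodule.subset_span ⟨_, rfl⟩)
    rw [← Multiset.coe_eq_coe, Multiset.ext]
    intro p
    rw [count_exponentWord]
  · push Not at hcount
    obtain ⟨p, hp⟩ := hcount
    obtain ⟨s, hs⟩ := Multiset.le_iff_exists_add.mp (Multiset.le_count_iff_replicate_le.mp hp)
    obtain ⟨L', rfl⟩ := Quot.exists_rep s
    -- The excess power is collected at the right end, because the ideal is a left ideal.
    have hL'' : L.Perm (L' ++ List.replicate (exponentBound N m p) p) := by
      rw [← Multiset.coe_eq_coe, hs]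
      exact add_comm _ _
    refine hperm _ hL'' ?_
    obtain ⟨c, hc⟩ := exists_gen_pow_sub_mem (m := m) (q := q) p
    have hmem := Submodule.smul_mem _ (wordProd q L') hc
    rw [smul_eq_mul, mul_sub, Algebra.algebraMap_eq_smul_one, mul_smul_comm, mul_one] at hmem
    have heq : verma N m q (wordProd q (L' ++ List.replicate (exponentBound N m p) p)) =
        c • verma N m q (wordProd q L') := by
      rw [← map_smul, ← sub_eq_zero, ← map_sub, wordProd_append]
      refine (Submodule.Quotient.mk_eq_zero _).mpr ?_
      simpa [wordProd] using hmem
    rw [heq]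
    refine P.smul_mem c (ih (wordWeight L') ?_ L' rfl)
    rw [← hL, hL''.wordWeight_eq, wordWeight_append]
    have hpos := exponentBound_pos (N := N) hm p
    simp only [wordWeight, List.map_replicate, List.sum_replicate, smul_eq_mul]
    have := Nat.mul_pos hpos (Nat.mul_pos (Nat.succ_pos (p.1 : ℕ)) (Nat.succ_pos (p.2 : ℕ)))
    simp only [Nat.succ_eq_add_one] at this
    omega

lemma span_exponentWord (hm : 0 < m) (hq : q ≠ 0) : Submodule.span ℂ
    (Set.range fun α : Exponents N m => verma N m q (wordProd q (exponentWord α))) = ⊤ := by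
  rw [eq_top_iff]
  rintro x -
  obtain ⟨x, rfl⟩ := Submodule.mkQ_surjective _ x
  have hx : x ∈ Submodule.span ℂ (Set.range (wordProd (n := N + 1) q)) := by
    rw [span_wordProd]
    trivial
  have hle : Submodule.span ℂ (Set.range (wordProd (n := N + 1) q)) ≤ (Submodule.span ℂ
      (Set.range fun α : Exponents N m => verma N m q (wordProd q (exponentWord α)))).comap
        (verma N m q) := by
    rw [Submodule.span_le]
    rintro _ ⟨L, rfl⟩
    exact verma_wordProd_mem hm hq _ L rfl
  exact hle hx

end UpperBound

/-! ### Comparison of the module with the representation. -/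

section Main

variable {N m : ℕ} {u : ℂˣ}

/-- The representation of `J⁰_q(N + 1)` on functions of the exponents. -/
def rep (hm : 0 < m) (hu : IsPrimitiveRoot (u : ℂ) m) :
    JZero (N + 1) u →ₐ[ℂ] Module.End ℂ (Exponents N m → ℂ) :=
  RingQuot.liftAlgHom ℂ ⟨FreeAlgebra.lift ℂ fun p => repEntry N m u p.1 p.2, fun x y h => by
    cases h with
    | comm i j s t h =>
      simp only [map_mul, map_smul, FreeAlgebra.lift_ι_apply]
      exact repEntry_comm hm hu (by omega) (by omega) (by omega) (by omega) h
    | cross i j s t his hjt =>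
      simp only [map_mul, map_smul, map_add, FreeAlgebra.lift_ι_apply]
      exact repEntry_cross hm hu (by omega) (by omega) his hjt⟩

lemma rep_gen (hm : 0 < m) (hu : IsPrimitiveRoot (u : ℂ) m) (i j : Fin (N + 1)) :
    rep hm hu (JZero.gen (N + 1) u i j) = repEntry N m u i j := by
  rw [rep, JZero.gen, RingQuot.liftAlgHom_mkAlgHom_apply, FreeAlgebra.lift_ι_apply]

variable (hm : 0 < m) (hN : 0 < N) (hu : IsPrimitiveRoot (u : ℂ) m)
include hN

lemma rep_apply_eq_zero {x : JZero (N + 1) u}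
    (hx : x ∈ restrictedVermaIdeal (N + 1) u m (fun _ => 1) 1) :
    rep hm hu x (Pi.single (vacuum N hm) 1) = 0 := by
  induction hx using Submodule.span_induction with
  | mem x hx =>
    cases hx with
    | raising i j h =>
      rw [rep_gen, repEntry_raising hm hu (by omega) (by omega) (by omega)]
    | weight k l h =>
      have hk := k.2
      rw [map_sub, rep_gen, show (l : ℕ) = N - k by omega, LinearMap.sub_apply,
        repEntry_diagonal hm hu (by omega), map_one, map_one, Module.End.one_apply, sub_self]
    | cyclic i j hi hj =>
      rw [map_sub, map_pow, rep_gen, show (i : ℕ) = N - 1 by omega, show (j : ℕ) = 0 by omega,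
        LinearMap.sub_apply, repEntry_cyclic_pow hm hN hu, map_one, map_one,
        Module.End.one_apply, sub_self]
    | nilpotent i j h hne =>
      rw [map_pow, rep_gen, repEntry_nilpotent_pow hm hu (by omega) (by omega)]
  | zero => simp
  | add x y _ _ hx hy => rw [map_add, LinearMap.add_apply, hx, hy, add_zero]
  | smul a x _ hx => rw [smul_eq_mul, map_mul, Module.End.mul_apply, hx, map_zero]

/-- The map from the restricted Verma module to the functions of the exponents. -/
def vermaToFun : RestrictedVerma (N + 1) u m (fun _ => 1) 1 →ₗ[ℂ] (Exponents N m → ℂ) where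
  toFun := Quotient.lift (fun x => rep hm hu x (Pi.single (vacuum N hm) 1)) fun x y h => by
    have h := (Submodule.quotientRel_def _).mp h
    have := rep_apply_eq_zero hm hN hu h
    rwa [map_sub, LinearMap.sub_apply, sub_eq_zero] at this
  map_add' x y := by
    obtain ⟨x, rfl⟩ := Submodule.mkQ_surjective _ x
    obtain ⟨y, rfl⟩ := Submodule.mkQ_surjective _ y
    exact congrArg (fun T : Module.End ℂ (Exponents N m → ℂ) => T (Pi.single (vacuum N hm) 1))
      (map_add (rep hm hu) x y)
  map_smul' c x := by
    obtain ⟨x, rfl⟩ := Submodule.mkQ_surjective _ x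
    exact congrArg (fun T : Module.End ℂ (Exponents N m → ℂ) => T (Pi.single (vacuum N hm) 1))
      (map_smul (rep hm hu) c x)

lemma vermaToFun_mk (x : JZero (N + 1) u) :
    vermaToFun hm hN hu (Submodule.Quotient.mk x) = rep hm hu x (Pi.single (vacuum N hm) 1) := rfl

lemma vermaToFun_smul (a : JZero (N + 1) u) (x : RestrictedVerma (N + 1) u m (fun _ => 1) 1) :
    vermaToFun hm hN hu (a • x) = rep hm hu a (vermaToFun hm hN hu x) := by
  obtain ⟨x, rfl⟩ := Submodule.mkQ_surjective _ x
  exact congrArg (fun T : Module.End ℂ (Exponents N m → ℂ) => T (Pi.single (vacuum N hm) 1))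
    (map_mul (rep hm hu) a x)

/-- The image of a submodule of the restricted Verma module is zero or everything. -/
lemma map_vermaToFun_eq_top
    (P : Submodule (JZero (N + 1) u) (RestrictedVerma (N + 1) u m (fun _ => 1) 1))
    (hP : (P.restrictScalars ℂ).map (vermaToFun hm hN hu) ≠ ⊥) :
    (P.restrictScalars ℂ).map (vermaToFun hm hN hu) = ⊤ := by
  refine eq_top_of_ne_bot hm hN hu ?_ hP
  rintro i hi j hj _ ⟨x, hx, rfl⟩
  refine ⟨JZero.gen (N + 1) u ⟨i, by omega⟩ ⟨j, by omega⟩ • x, P.smul_mem _ hx, ?_⟩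
  rw [vermaToFun_smul, rep_gen]

/-- The image is a nonzero invariant subspace, since it contains the vacuum. -/
lemma vermaToFun_surjective : Function.Surjective (vermaToFun hm hN hu) := by
  rw [← LinearMap.range_eq_top, LinearMap.range_eq_map]
  refine map_vermaToFun_eq_top hm hN hu ⊤ ?_
  rw [Submodule.ne_bot_iff]
  refine ⟨_, ⟨Submodule.Quotient.mk 1, trivial, rfl⟩, ?_⟩
  rw [vermaToFun_mk, map_one, Module.End.one_apply]
  exact fun h => one_ne_zero (α := ℂ) (by simpa using congrFun h (vacuum N hm))

omit hN in
include hm hu in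
lemma finite_restrictedVerma :
    FiniteDimensional ℂ (RestrictedVerma (N + 1) u m (fun _ => 1) 1) :=
  ⟨Submodule.fg_def.mpr ⟨_, Set.finite_range _, span_exponentWord hm u.ne_zero⟩⟩

include hm hu in
-- The spanning monomials bound the dimension from above, and the surjection onto functions of the
-- exponents bounds it from below.
lemma finrank_restrictedVerma :
    Module.finrank ℂ (RestrictedVerma (N + 1) u m (fun _ => 1) 1) =
      Fintype.card (Exponents N m) := by
  have := finite_restrictedVerma (N := N) hm hu
  apply le_antisymm
  · have := finrank_range_le_card (R := ℂ)
      (fun α : Exponents N m => verma N m (u : ℂ) (wordProd (u : ℂ) (exponentWord α)))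
    rwa [Set.finrank, span_exponentWord hm u.ne_zero, finrank_top] at this
  · rw [← Module.finrank_pi ℂ]
    exact LinearMap.finrank_le_finrank_of_surjective (vermaToFun_surjective hm hN hu)

lemma vermaToFun_injective : Function.Injective (vermaToFun hm hN hu) := by
  have := finite_restrictedVerma (N := N) hm hu
  refine (LinearMap.injective_iff_surjective_of_finrank_eq_finrank ?_).mpr
    (vermaToFun_surjective hm hN hu)
  rw [finrank_restrictedVerma hm hN hu, Module.finrank_pi]

include hm hu in
lemma isSimpleModule_restrictedVerma :
    IsSimpleModule (JZero (N + 1) u) (RestrictedVerma (N + 1) u m (fun _ => 1) 1) := by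
  have hinj := vermaToFun_injective hm hN hu
  have : Nontrivial (RestrictedVerma (N + 1) u m (fun _ => 1) 1) := by
    have : Nonempty (Exponents N m) := ⟨vacuum N hm⟩
    exact (vermaToFun_surjective hm hN hu).nontrivial
  rw [isSimpleModule_iff]
  refine { eq_bot_or_eq_top := fun P => ?_ }
  by_cases hP : P = ⊥
  · exact Or.inl hP
  right
  rw [eq_top_iff]
  rintro x -
  obtain ⟨y, hy, hy0⟩ := P.ne_bot_iff.mp hP
  have htop := map_vermaToFun_eq_top hm hN hu P (by
    rw [Submodule.ne_bot_iff]
    exact ⟨_, ⟨y, hy, rfl⟩, fun h => hy0 (hinj (by rw [h, map_zero]))⟩)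
  obtain ⟨z, hz, hzx⟩ : vermaToFun hm hN hu x ∈
      (P.restrictScalars ℂ).map (vermaToFun hm hN hu) := by
    rw [htop]
    trivial
  rw [← hinj hzx]
  exact hz

omit hu hm in
-- There are `N (N + 1) / 2` positions strictly above the antidiagonal; one of them is cyclic and
-- contributes `m`, and each of the other `(n² - n - 2) / 2` contributes `m'`.
lemma card_exponents (m : ℕ) : Fintype.card (Exponents N m) =
    m * mPrime m ^ (((N + 1) ^ 2 - (N + 1) - 2) / 2) := by
  rw [Fintype.card_pi]
  simp only [Fintype.card_fin]
  have hmem : position N N (N - 1) ∈ (Finset.univ : Finset (Fin (N + 1) × Fin (N + 1))) :=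
    Finset.mem_univ _
  rw [← Finset.mul_prod_erase _ _ hmem, exponentBound_position (by omega) le_rfl,
    if_pos (by omega)]
  congr 1
  set T := Finset.univ.filter fun p : Fin (N + 1) × Fin (N + 1) => (p.1 : ℕ) + p.2 + 1 ≤ N with hT
  have hcardT : T.card = ∑ k ∈ Finset.range (N + 1), (N - k) := by
    rw [hT, Finset.card_filter, Fintype.sum_prod_type, ← Fin.sum_univ_eq_sum_range]
    refine Finset.sum_congr rfl fun i _ => ?_
    rw [← Finset.card_filter]
    have : (Finset.univ.filter fun j : Fin (N + 1) => (i : ℕ) + j + 1 ≤ N) =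
        Finset.univ.filter fun j : Fin (N + 1) => (j : ℕ) < N - i :=
      Finset.filter_congr fun j _ => by omega
    rw [this, Fin.card_filter_val_lt]
    omega
  have hcard2 : T.card * 2 = (N + 1) * N := by
    have := Finset.sum_range_reflect (fun k => k) (N + 1)
    simp only [Nat.add_sub_cancel] at this
    rw [hcardT, this, Finset.sum_range_id_mul_two, Nat.add_sub_cancel]
  have hmemT : position N N (N - 1) ∈ T := by
    rw [hT, Finset.mem_filter, position_fst (by omega) le_rfl, position_snd]
    exact ⟨Finset.mem_univ _, by omega⟩
  have hprod : ∏ p ∈ Finset.univ.erase (position N N (N - 1)), exponentBound N m p =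
      ∏ p ∈ T.erase (position N N (N - 1)), mPrime m := by
    rw [← Finset.prod_subset (Finset.erase_subset_erase _ (Finset.subset_univ T))]
    · refine Finset.prod_congr rfl fun p hp => ?_
      obtain ⟨hne, hpT⟩ := Finset.mem_erase.mp hp
      rw [hT, Finset.mem_filter] at hpT
      rw [exponentBound, if_neg, if_pos hpT.2]
      rintro ⟨h1, h2⟩
      refine hne (Prod.ext (Fin.ext ?_) (Fin.ext ?_))
      · rw [position_fst (by omega) le_rfl]
        omega
      · rw [position_snd]
        omega
    · intro p hp hpT
      have hne := (Finset.mem_erase.mp hp).1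
      have hpT' : ¬ (p.1 : ℕ) + p.2 + 1 ≤ N := fun h =>
        hpT (Finset.mem_erase.mpr ⟨hne, by rw [hT, Finset.mem_filter]; exact ⟨Finset.mem_univ _, h⟩⟩)
      rw [exponentBound, if_neg (by omega), if_neg hpT']
  rw [hprod, Finset.prod_const, Finset.card_erase_of_mem hmemT]
  congr 1
  have : (N + 1) ^ 2 = (N + 1) * N + (N + 1) := by ring
  omega

end Main
end

theorem mainTheorem6 (n m : ℕ) (hn : 2 ≤ n) (hm : 0 < m) (q : ℂ) (hq : IsPrimitiveRoot q m) :
    IsSimpleModule (JZero n q) (RestrictedVerma n q m (fun _ => 1) 1) ∧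
    FiniteDimensional ℂ (RestrictedVerma n q m (fun _ => 1) 1) ∧
    Module.finrank ℂ (RestrictedVerma n q m (fun _ => 1) 1) =
      m * mPrime m ^ ((n ^ 2 - n - 2) / 2) := by
  obtain ⟨N, rfl⟩ : ∃ N, n = N + 1 := ⟨n - 1, by omega⟩
  obtain ⟨u, rfl⟩ : ∃ u : ℂˣ, (u : ℂ) = q := ⟨Units.mk0 q (hq.ne_zero hm.ne'), rfl⟩
  have hN : 0 < N := by omega
  exact ⟨isSimpleModule_restrictedVerma hm hN hq, finite_restrictedVerma hm hq,
    (finrank_restrictedVerma hm hN hq).trans (card_exponents hN m)⟩
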